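/- Let $(X,\mathcal B,\mu)$ be a standard Borel probability space, and let $L_p = L_p(X;\mathbb C)$. Let $U=(U_t)_{t\in\mathbb R}$ be a $C_0$-group on $L_2$, with generator $A$ (so $D(A)$ is the set of all $f\in L_2$ for which $Af=\lim_{t\to0}\frac1t(U_tf-f)$ exists in $L_2$). Assume that $U_t(L_\infty)\subset L_\infty$ for all $t\in\mathbb R$, that $\mathbb 1\in D(A)$ and that $A\mathbb 1\in L_\infty$. Then the following are equivalent. (i) $U$ is weighted non-singular, that is, for each $t\in\mathbb R$ there exist a map $T_t\colon X\to X$ and a function $\psi_t\colon X\to\mathbb C$ such that $U_tf=\psi_t\cdot(f\circ T_t)$ a.e. for every function $f$ representing an element of $L_2$. (ii) The space $D(A)\cap L_\infty$ is an algebra (it is closed under pointwise multiplication), and $B=A-(A\mathbb 1)I$, with domain $D(A)$, is a derivation on it, i.e. $B(fg)=(Bf)\,g+f\,(Bg)$ for all $f,g\in D(A)\cap L_\infty$. Moreover, if $(T_t)_{t\in\mathbb R}$ and $(\psi_t)_{t\in\mathbb R}$ are as in (i), then for every $r\in\mathbb R$ the function $(A\mathbb 1)\circ T_r$ represents an element of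 $L_2$, the map $r\mapsto(A\mathbb 1)\circ T_r$ is continuous from $\mathbb R$ into $L_2$, and for every $t\in\mathbb R$ one has $\psi_t\in L_\infty$ and $$\psi_t=\exp\Big(\int_0^t(A\mathbb 1)\circ T_r\,dr\Big)\quad\text{a.e.},$$ where the integral is the ($L_2$-valued) integral of this continuous map. -/

import Mathlib

open MeasureTheory Filter Topology
open scoped ENNReal

noncomputable section

namespace WeightedKoopman

section Group

variable {E : Type*} [NormedAddCommGroup E] [NormedSpace ℂ E]

/-- A one-parameter `C₀`-group of bounded operators on a complex normed space. -/
structure IsC0Group (U : ℝ → E →L[ℂ] E) : Prop where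
  map_zero : U 0 = ContinuousLinearMap.id ℂ E
  map_add : ∀ s t : ℝ, U (s + t) = (U s).comp (U t)
  continuous_orbit : ∀ f : E, Continuous fun t : ℝ => U t f

/-- `g` is the derivative at `t = 0` of the orbit `t ↦ U t f`. -/
def HasOrbitDeriv (U : ℝ → E →L[ℂ] E) (f g : E) : Prop :=
  Tendsto (fun t : ℝ => ((t : ℂ)⁻¹) • (U t f - f)) (𝓝[≠] 0) (𝓝 g)

theorem HasOrbitDeriv.add {U : ℝ → E →L[ℂ] E} {f g f' g' : E} (hf : HasOrbitDeriv U f f')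
    (hg : HasOrbitDeriv U g g') : HasOrbitDeriv U (f + g) (f' + g') := by
  refine (Tendsto.add hf hg).congr fun t => ?_
  rw [← smul_add, map_add]
  congr 1
  abel

theorem HasOrbitDeriv.smul {U : ℝ → E →L[ℂ] E} {f f' : E} (c : ℂ) (hf : HasOrbitDeriv U f f') :
    HasOrbitDeriv U (c • f) (c • f') := by
  refine (Tendsto.const_smul hf c).congr fun t => ?_
  rw [map_smul, ← smul_sub, smul_comm]

theorem HasOrbitDeriv.unique {U : ℝ → E →L[ℂ] E} {f g g' : E} (h : HasOrbitDeriv U f g)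
    (h' : HasOrbitDeriv U f g') : g = g' :=
  tendsto_nhds_unique h h'

/-- The infinitesimal generator `A`: the domain `D(A)` consists of all `f` for which
`lim_{t → 0} t⁻¹ (U_t f - f)` exists in norm, and `A f` is that limit. -/
def generator (U : ℝ → E →L[ℂ] E) : E →ₗ.[ℂ] E where
  domain :=
    { carrier := {f | ∃ g, HasOrbitDeriv U f g}
      add_mem' := fun ⟨_, ha⟩ ⟨_, hb⟩ => ⟨_, ha.add hb⟩
      zero_mem' := ⟨0, by simp [HasOrbitDeriv]⟩
      smul_mem' := fun c _ ⟨_, ha⟩ => ⟨_, ha.smul c⟩ }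
  toFun :=
    { toFun := fun f => Classical.choose f.2
      map_add' := fun f g =>
        (Classical.choose_spec (f + g).2).unique
          ((Classical.choose_spec f.2).add (Classical.choose_spec g.2))
      map_smul' := fun c f =>
        (Classical.choose_spec (c • f).2).unique ((Classical.choose_spec f.2).smul c) }

theorem generator_spec (U : ℝ → E →L[ℂ] E) (f : (generator U).domain) :
    HasOrbitDeriv U f (generator U f) :=
  Classical.choose_spec f.2

end Group

section Functions

variable {X : Type*} [MeasurableSpace X]

/-- The space `L_∞(X)`, viewed inside `L₂(X)` (which contains it when `μ` is finite). -/
def linf (μ : Measure X) : Submodule ℂ (Lp ℂ 2 μ) where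
  carrier := {f | MemLp f ∞ μ}
  add_mem' := fun {f g} hf hg => (MemLp.add hf hg).ae_eq (Lp.coeFn_add f g).symm
  zero_mem' := MemLp.zero.ae_eq (Lp.coeFn_zero ℂ 2 μ).symm
  smul_mem' := fun c f hf => (MemLp.const_smul hf c).ae_eq (Lp.coeFn_smul c f).symm

/-- The constant function `𝟙` as an element of `L₂(X)`. -/
def one (μ : Measure X) [IsFiniteMeasure μ] : Lp ℂ 2 μ := Lp.const 2 μ (1 : ℂ)

variable {μ : Measure X}

theorem memLp_mul {m : Lp ℂ 2 μ} (hm : m ∈ linf μ) (f : Lp ℂ 2 μ) :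
    MemLp (fun x => m x * f x) 2 μ :=
  MemLp.mul' (Lp.memLp f) (show MemLp m ∞ μ from hm)

/-- Multiplication by `m ∈ L_∞(X)`, as an operator on `L₂(X)`. -/
def mulOp (m : Lp ℂ 2 μ) (hm : m ∈ linf μ) : Lp ℂ 2 μ →ₗ[ℂ] Lp ℂ 2 μ where
  toFun f := (memLp_mul hm f).toLp
  map_add' f g := by
    rw [← MemLp.toLp_add, MemLp.toLp_eq_toLp_iff]
    filter_upwards [Lp.coeFn_add f g] with x hx
    simp only [hx, Pi.add_apply]
    ring
  map_smul' c f := by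
    rw [RingHom.id_apply, ← MemLp.toLp_const_smul, MemLp.toLp_eq_toLp_iff]
    filter_upwards [Lp.coeFn_smul c f] with x hx
    simp only [hx, Pi.smul_apply, smul_eq_mul]
    ring

/-- The operator `A - m I` with domain `D(A)`, for `m ∈ L_∞(X)`. -/
def subMul (A : Lp ℂ 2 μ →ₗ.[ℂ] Lp ℂ 2 μ) (m : Lp ℂ 2 μ) (hm : m ∈ linf μ) :
    Lp ℂ 2 μ →ₗ.[ℂ] Lp ℂ 2 μ where
  domain := A.domain
  toFun := A.toFun - (mulOp m hm).comp A.domain.subtype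

/-- The linear space `D` of (classes of) functions is an algebra: it contains the pointwise
product of any two of its elements. -/
def IsAlgebra (D : Submodule ℂ (Lp ℂ 2 μ)) : Prop :=
  ∀ f ∈ D, ∀ g ∈ D, ∃ h ∈ D, h =ᵐ[μ] fun x => f x * g x

/-- `B` is a derivation on `D`: one has `B (f g) = (B f) g + f (B g)` for all `f, g ∈ D`
(here `h` is the product `f g`). -/
def IsDerivationOn (B : Lp ℂ 2 μ →ₗ.[ℂ] Lp ℂ 2 μ) (D : Submodule ℂ (Lp ℂ 2 μ)) : Prop :=
  ∀ f g h : B.domain, (f : Lp ℂ 2 μ) ∈ D → (g : Lp ℂ 2 μ) ∈ D →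
    ((h : Lp ℂ 2 μ) =ᵐ[μ] fun x => (f : Lp ℂ 2 μ) x * (g : Lp ℂ 2 μ) x) →
    B h =ᵐ[μ] fun x => B f x * (g : Lp ℂ 2 μ) x + (f : Lp ℂ 2 μ) x * B g x

/-- `U_t f = ψ_t · (f ∘ T_t)` for all `t ∈ ℝ` and `f ∈ L₂(X)`. The identity is required for every
function `f` representing an element of `L₂(X)`, so that it is meaningful for classes; for a
one-parameter group this forces each `ψ_t` to be a.e. nonzero and each `T_t` to be
a.e.-measurable and non-singular. -/
def IsWeightedComposition (U : ℝ → Lp ℂ 2 μ →L[ℂ] Lp ℂ 2 μ) (T : ℝ → X → X)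
    (ψ : ℝ → X → ℂ) : Prop :=
  ∀ (t : ℝ) (f : X → ℂ) (hf : MemLp f 2 μ), U t hf.toLp =ᵐ[μ] fun x => ψ t x * f (T t x)

/-- `U` is weighted non-singular. -/
def IsWeightedNonsingular (U : ℝ → Lp ℂ 2 μ →L[ℂ] Lp ℂ 2 μ) : Prop :=
  ∃ (T : ℝ → X → X) (ψ : ℝ → X → ℂ), IsWeightedComposition U T ψ

end Functions

end WeightedKoopman

end

/-! Write `a = A 𝟙`. Both conditions are equivalent to a third, `IsWeightedMul`: `U_t(fg) · U_t 𝟙 =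
U_t f · U_t g` for bounded `f`, `g`. In terms of `A` itself, condition (ii) is the product rule
`A(fg) = f Ag + (Af) g - a f g`, called `IsLeibniz`.

From the product rule to multiplicativity: for `f`, `g` in `D(A) ∩ L_∞`, both sides of the identity
solve `R' = A R + a R` with initial value `fg`. Variation of constants and Gronwall make the
solution unique (`IsC0Group.eq_zero_of_deriv`). The averages `d⁻¹ ∫_0^d U_s f ds` carry the identity
over to all of `L_∞`.

From multiplicativity to a point map: `U_t 𝟙` has a bounded inverse, so `V = (U_t 𝟙)⁻¹ U_t` is
unital and multiplicative on `L_∞`. It sends indicators to indicators and respects countable unions;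
on a standard Borel space such a set map is induced by a point map (`exists_mapsInd_preimage`).

Conversely, a weighted composition group yields `W_t f = f ∘ T_t`, which is strongly continuous on
bounded functions, and the product rule is a difference quotient computation. For the weight, `(U_t
𝟙)' = U_t a = U_t 𝟙 · W_t a`, so `exp(-∫_0^t W_r a dr) · U_t 𝟙` is constant.

Products are not continuous on `L₂`. Every limit of products therefore needs one factor bounded in
`L_∞`, locally uniformly in the parameter; `tendsto_pmul` and `IsC0Group.eventually_mem_supBall`
supply this. -/

noncomputable section

namespace WeightedKoopman

/-! ### Products, exponentials and sup-norm bounds inside `L₂` -/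

section Product

variable {X : Type*} [MeasurableSpace X] {μ : Measure X}

/-- The pointwise product of two elements of `L₂`, with the junk value `0` when it is not in
`L₂`. -/
def pmul (f g : Lp ℂ 2 μ) : Lp ℂ 2 μ :=
  open Classical in if h : MemLp (fun x => f x * g x) 2 μ then h.toLp else 0

/-- The elements of `L₂` bounded by `C` almost everywhere. -/
def supBall (μ : Measure X) (C : ℝ) : Set (Lp ℂ 2 μ) := {f | ∀ᵐ x ∂μ, ‖f x‖ ≤ C}

theorem mem_supBall {C : ℝ} {f : Lp ℂ 2 μ} : f ∈ supBall μ C ↔ ∀ᵐ x ∂μ, ‖f x‖ ≤ C := Iff.rfl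

theorem mem_linf {f : Lp ℂ 2 μ} : f ∈ linf μ ↔ MemLp f ∞ μ := Iff.rfl

theorem linf_of_mem_supBall {C : ℝ} {f : Lp ℂ 2 μ} (hf : f ∈ supBall μ C) : f ∈ linf μ :=
  memLp_top_of_bound (Lp.aestronglyMeasurable f) C hf

theorem exists_mem_supBall_of_linf {f : Lp ℂ 2 μ} (hf : f ∈ linf μ) :
    ∃ C : ℝ, 0 ≤ C ∧ f ∈ supBall μ C := by
  refine ⟨(eLpNorm f ∞ μ).toReal, ENNReal.toReal_nonneg, ?_⟩
  have hfin : eLpNormEssSup f μ ≠ ∞ := by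
    have := (mem_linf.1 hf).eLpNorm_ne_top
    rwa [eLpNorm_exponent_top] at this
  rw [eLpNorm_exponent_top]
  filter_upwards [ae_le_eLpNormEssSup (f := f) (μ := μ)] with x hx
  have := ENNReal.toReal_mono hfin hx
  simpa using this

theorem supBall_mono {C D : ℝ} (h : C ≤ D) : supBall μ C ⊆ supBall μ D :=
  fun _ hf => (mem_supBall.1 hf).mono fun _ hx => hx.trans h

theorem isClosed_supBall (C : ℝ) : IsClosed (supBall μ C) := by
  refine isClosed_of_closure_subset fun f hf => ?_
  obtain ⟨u, hu, hlim⟩ := mem_closure_iff_seq_limit.1 hf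
  obtain ⟨ns, -, hns⟩ := (tendstoInMeasure_of_tendsto_Lp hlim).exists_seq_tendsto_ae
  have hall : ∀ᵐ x ∂μ, ∀ n, ‖u n x‖ ≤ C := ae_all_iff.2 hu
  filter_upwards [hns, hall] with x h1 h2
  exact le_of_tendsto h1.norm (Eventually.of_forall fun i => h2 _)

theorem coeFn_real_smul (c : ℝ) (f : Lp ℂ 2 μ) :
    (c • f : Lp ℂ 2 μ) =ᵐ[μ] fun x => (c : ℂ) * f x := by
  filter_upwards [Lp.coeFn_smul c f] with x hx
  rw [hx, Pi.smul_apply, Complex.real_smul]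

theorem supBall_smul_mem {C : ℝ} {f : Lp ℂ 2 μ} (hf : f ∈ supBall μ C) (c : ℝ) :
    c • f ∈ supBall μ (|c| * C) := by
  filter_upwards [hf, coeFn_real_smul c f] with x hx hc
  rw [hc, norm_mul, Complex.norm_real, Real.norm_eq_abs]
  gcongr

theorem supBall_add_mem {C D : ℝ} {f g : Lp ℂ 2 μ} (hf : f ∈ supBall μ C) (hg : g ∈ supBall μ D) :
    f + g ∈ supBall μ (C + D) := by
  filter_upwards [hf, hg, Lp.coeFn_add f g] with x h1 h2 h3
  rw [h3, Pi.add_apply]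
  exact (norm_add_le _ _).trans (add_le_add h1 h2)

theorem convex_supBall (C : ℝ) : Convex ℝ (supBall μ C) := by
  intro f hf g hg a b ha hb hab
  have := supBall_add_mem (supBall_smul_mem hf a) (supBall_smul_mem hg b)
  rwa [abs_of_nonneg ha, abs_of_nonneg hb, ← add_mul, hab, one_mul] at this

/-- A sup-norm ball is convex and closed in `L₂`, so it contains averages of an `L₂`-continuous map.
This transfers pointwise bounds to the `L₂`-valued integral without any joint measurability in `r`
and `x`. -/
theorem integral_mem_supBall {g : ℝ → Lp ℂ 2 μ} (hg : Continuous g) {C a b : ℝ}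
    (h : ∀ r ∈ Set.uIcc a b, g r ∈ supBall μ C) :
    (∫ r in a..b, g r) ∈ supBall μ (C * |b - a|) := by
  wlog hab : a ≤ b generalizing a b
  · rw [intervalIntegral.integral_symm]
    have := supBall_smul_mem (this (Set.uIcc_comm a b ▸ h) (le_of_not_ge hab)) (-1)
    rw [abs_sub_comm]
    simpa using this
  rcases hab.eq_or_lt with rfl | hlt
  · simp only [intervalIntegral.integral_same, sub_self, abs_zero, mul_zero]
    filter_upwards [Lp.coeFn_zero ℂ 2 μ] with x hx
    rw [hx]
    simp
  have hpos : 0 < b - a := sub_pos.2 hlt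
  have hav : (⨍ r in Set.Ioc a b, g r) ∈ supBall μ C := by
    refine (convex_supBall C).set_average_mem (isClosed_supBall C) ?_ ?_ ?_ ?_
    · simpa using hlt
    · simp
    · refine (ae_restrict_iff' measurableSet_Ioc).2 (Eventually.of_forall fun r hr => h r ?_)
      rw [Set.uIcc_of_le hab]
      exact ⟨hr.1.le, hr.2⟩
    · exact hg.integrableOn_Ioc
  have := supBall_smul_mem hav (b - a)
  rw [setAverage_eq, measureReal_def, Real.volume_Ioc, ENNReal.toReal_ofReal hpos.le, smul_smul,
    mul_inv_cancel₀ hpos.ne', one_smul, ← intervalIntegral.integral_of_le hab, mul_comm] at this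
  exact this

theorem coeFn_pmul_of_memLp {f g : Lp ℂ 2 μ} (h : MemLp (fun x => f x * g x) 2 μ) :
    pmul f g =ᵐ[μ] fun x => f x * g x := by
  rw [pmul, dif_pos h]
  exact h.coeFn_toLp

theorem coeFn_pmul {f : Lp ℂ 2 μ} (hf : f ∈ linf μ) (g : Lp ℂ 2 μ) :
    pmul f g =ᵐ[μ] fun x => f x * g x :=
  coeFn_pmul_of_memLp (memLp_mul hf g)

theorem pmul_comm (f g : Lp ℂ 2 μ) : pmul f g = pmul g f := by
  have h : (fun x => f x * g x) = fun x => g x * f x := funext fun x => mul_comm _ _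
  unfold pmul
  generalize (fun x => f x * g x) = a at h ⊢
  subst h
  rfl

theorem coeFn_pmul' (f : Lp ℂ 2 μ) {g : Lp ℂ 2 μ} (hg : g ∈ linf μ) :
    pmul f g =ᵐ[μ] fun x => f x * g x := by
  rw [pmul_comm]
  simpa only [mul_comm] using coeFn_pmul hg f

theorem norm_pmul_le {C : ℝ} {f : Lp ℂ 2 μ} (hf : f ∈ supBall μ C) (g : Lp ℂ 2 μ) :
    ‖pmul f g‖ ≤ C * ‖g‖ := by
  refine Lp.norm_le_mul_norm_of_ae_le_mul ?_
  filter_upwards [hf, coeFn_pmul (linf_of_mem_supBall hf) g] with x h1 h2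
  rw [h2, norm_mul]
  gcongr

theorem pmul_mem_supBall {C D : ℝ} {f g : Lp ℂ 2 μ} (hC : 0 ≤ C) (hf : f ∈ supBall μ C)
    (hg : g ∈ supBall μ D) : pmul f g ∈ supBall μ (C * D) := by
  filter_upwards [hf, hg, coeFn_pmul (linf_of_mem_supBall hf) g] with x h1 h2 h3
  rw [h3, norm_mul]
  gcongr

theorem pmul_mem_linf {f g : Lp ℂ 2 μ} (hf : f ∈ linf μ) (hg : g ∈ linf μ) :
    pmul f g ∈ linf μ := by
  obtain ⟨C, hC, hf⟩ := exists_mem_supBall_of_linf hf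
  obtain ⟨D, -, hg⟩ := exists_mem_supBall_of_linf hg
  exact linf_of_mem_supBall (pmul_mem_supBall hC hf hg)

theorem pmul_sub {f : Lp ℂ 2 μ} (hf : f ∈ linf μ) (g h : Lp ℂ 2 μ) :
    pmul f (g - h) = pmul f g - pmul f h := by
  refine Lp.ext ?_
  filter_upwards [coeFn_pmul hf (g - h), coeFn_pmul hf g, coeFn_pmul hf h,
    Lp.coeFn_sub (pmul f g) (pmul f h), Lp.coeFn_sub g h] with x h1 h2 h3 h4 h5
  rw [h1, h4, Pi.sub_apply, h2, h3, h5, Pi.sub_apply, mul_sub]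

theorem sub_pmul' {f g : Lp ℂ 2 μ} (hf : f ∈ linf μ) (hg : g ∈ linf μ) (h : Lp ℂ 2 μ) :
    pmul (f - g) h = pmul f h - pmul g h := by
  refine Lp.ext ?_
  filter_upwards [coeFn_pmul (sub_mem hf hg) h, coeFn_pmul hf h, coeFn_pmul hg h,
    Lp.coeFn_sub (pmul f h) (pmul g h), Lp.coeFn_sub f g] with x h1 h2 h3 h4 h5
  rw [h1, h4, Pi.sub_apply, h2, h3, h5, Pi.sub_apply, sub_mul]

theorem pmul_smul {f : Lp ℂ 2 μ} (hf : f ∈ linf μ) (c : ℝ) (g : Lp ℂ 2 μ) :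
    pmul f (c • g) = c • pmul f g := by
  refine Lp.ext ?_
  filter_upwards [coeFn_pmul hf (c • g), coeFn_pmul hf g, coeFn_real_smul c g,
    coeFn_real_smul c (pmul f g)] with x h1 h2 h3 h4
  rw [h1, h3, h4, h2]
  ring

theorem pmul_assoc {f g : Lp ℂ 2 μ} (hf : f ∈ linf μ) (hg : g ∈ linf μ) (h : Lp ℂ 2 μ) :
    pmul (pmul f g) h = pmul f (pmul g h) := by
  refine Lp.ext ?_
  filter_upwards [coeFn_pmul (pmul_mem_linf hf hg) h, coeFn_pmul hf g, coeFn_pmul hf (pmul g h),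
    coeFn_pmul hg h] with x h1 h2 h3 h4
  rw [h1, h3, h2, h4, mul_assoc]

theorem exists_linf_norm_sub_lt (f : Lp ℂ 2 μ) {ε : ℝ} (hε : 0 < ε) :
    ∃ k ∈ linf μ, ‖f - k‖ < ε := by
  obtain ⟨k, hk, hd⟩ := (Lp.simpleFunc.dense (E := ℂ) (p := 2) (μ := μ) (by simp)).exists_dist_lt f hε
  refine ⟨k, ?_, by rwa [dist_eq_norm] at hd⟩
  have h := Lp.simpleFunc.toSimpleFunc_eq_toFun ⟨k, hk⟩
  exact ((Lp.simpleFunc.toSimpleFunc ⟨k, hk⟩).memLp_top μ).ae_eq h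

/-- Multiplication is jointly sequentially continuous in the `L₂`-norm when the first factor stays
bounded in `L_∞`. -/
theorem tendsto_pmul {ι : Type*} {l : Filter ι} {m f : ι → Lp ℂ 2 μ} {m₀ f₀ : Lp ℂ 2 μ} {C : ℝ}
    (hm : Tendsto m l (𝓝 m₀)) (hf : Tendsto f l (𝓝 f₀)) (hC : ∀ᶠ i in l, m i ∈ supBall μ C) :
    Tendsto (fun i => pmul (m i) (f i)) l (𝓝 (pmul m₀ f₀)) := by
  rcases l.eq_or_neBot with rfl | hl
  · simp
  have hm₀ : m₀ ∈ supBall μ C := (isClosed_supBall C).mem_of_tendsto hm hC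
  have hl₀ := linf_of_mem_supBall hm₀
  have hfix : Tendsto (fun i => pmul (m i) f₀) l (𝓝 (pmul m₀ f₀)) := by
    rw [Metric.tendsto_nhds]
    intro ε hε
    -- Bounded approximation of `f₀`: the remainder `f₀ - k` meets `m i - m₀`, which is bounded by
    -- `2|C|`, while the bounded `k` meets the small `L₂`-norm of `m i - m₀`. The `+ 1` keeps the
    -- denominator nonzero.
    obtain ⟨k, hk, hkd⟩ := exists_linf_norm_sub_lt f₀
      (show 0 < ε / (2 * (|C| + |C| + 1)) by positivity)
    obtain ⟨K, hK0, hK⟩ := exists_mem_supBall_of_linf hk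
    have h0 : ∀ᶠ i in l, K * ‖m i - m₀‖ < ε / 2 := by
      have : Tendsto (fun i => K * ‖m i - m₀‖) l (𝓝 (K * 0)) :=
        (tendsto_iff_norm_sub_tendsto_zero.1 hm).const_mul K
      rw [mul_zero] at this
      exact this.eventually_lt_const (by positivity)
    filter_upwards [hC, h0] with i hi hi0
    have hli := linf_of_mem_supBall hi
    have hd : m i - m₀ ∈ supBall μ (|C| + |C|) := by
      have := supBall_add_mem (supBall_mono (le_abs_self C) hi)
        (supBall_smul_mem (supBall_mono (le_abs_self C) hm₀) (-1))
      simpa [sub_eq_add_neg] using this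
    have hld := linf_of_mem_supBall hd
    have e : pmul (m i) f₀ - pmul m₀ f₀ = pmul (m i - m₀) (f₀ - k) + pmul k (m i - m₀) := by
      rw [pmul_sub hld, pmul_comm k, sub_add_cancel, sub_pmul' hli hl₀]
    rw [dist_eq_norm, e]
    calc _ ≤ (|C| + |C|) * ‖f₀ - k‖ + K * ‖m i - m₀‖ :=
          (norm_add_le _ _).trans (add_le_add (norm_pmul_le hd _) (norm_pmul_le hK _))
      _ ≤ (|C| + |C| + 1) * (ε / (2 * (|C| + |C| + 1))) + K * ‖m i - m₀‖ := by
          refine add_le_add_left (mul_le_mul ?_ hkd.le (norm_nonneg _) (by positivity)) _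
          linarith
      _ = ε / 2 + K * ‖m i - m₀‖ := by
          field_simp
      _ < ε := by linarith
  have hzero : Tendsto (fun i => pmul (m i) (f i) - pmul (m i) f₀) l (𝓝 0) := by
    have hlim : Tendsto (fun i => C * ‖f i - f₀‖) l (𝓝 0) := by
      simpa using (tendsto_iff_norm_sub_tendsto_zero.1 hf).const_mul C
    refine squeeze_zero_norm' ?_ hlim
    filter_upwards [hC] with i hi
    rw [← pmul_sub (linf_of_mem_supBall hi)]
    exact norm_pmul_le hi _
  simpa using hzero.add hfix

theorem tendsto_const_pmul {ι : Type*} {l : Filter ι} {m : Lp ℂ 2 μ} (hm : m ∈ linf μ)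
    {f : ι → Lp ℂ 2 μ} {f₀ : Lp ℂ 2 μ} (hf : Tendsto f l (𝓝 f₀)) :
    Tendsto (fun i => pmul m (f i)) l (𝓝 (pmul m f₀)) := by
  obtain ⟨C, -, hC⟩ := exists_mem_supBall_of_linf hm
  exact tendsto_pmul tendsto_const_nhds hf (Eventually.of_forall fun _ => hC)

/-- The difference quotient splits as `F s` times the slope of `G`, plus `G t` times the slope of
`F`. Hence `F` must be bounded near `t`, but `G` only at `t`. -/
theorem hasDerivAt_pmul {F G : ℝ → Lp ℂ 2 μ} {F' G' : Lp ℂ 2 μ} {t C : ℝ}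
    (hF : HasDerivAt F F' t) (hG : HasDerivAt G G' t) (hC : ∀ᶠ s in 𝓝 t, F s ∈ supBall μ C)
    (hGt : G t ∈ linf μ) :
    HasDerivAt (fun s => pmul (F s) (G s)) (pmul (F t) G' + pmul F' (G t)) t := by
  have hFc := hF.continuousAt.tendsto
  rw [hasDerivAt_iff_tendsto_slope] at hF hG ⊢
  have h1 := tendsto_pmul (hFc.mono_left nhdsWithin_le_nhds) hG (hC.filter_mono nhdsWithin_le_nhds)
  have h2 := tendsto_const_pmul hGt hF
  rw [pmul_comm F']
  refine (h1.add h2).congr' ?_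
  filter_upwards [hC.filter_mono nhdsWithin_le_nhds] with s hs
  have hl := linf_of_mem_supBall hs
  rw [slope_def_module, slope_def_module, slope_def_module, pmul_smul hl, pmul_smul hGt,
    ← smul_add, pmul_sub hl, pmul_sub hGt, pmul_comm (G t), pmul_comm (G t)]
  congr 1
  abel

theorem hasDerivAt_const_pmul {m : Lp ℂ 2 μ} (hm : m ∈ linf μ) {F : ℝ → Lp ℂ 2 μ} {F' : Lp ℂ 2 μ}
    {t : ℝ} (hF : HasDerivAt F F' t) : HasDerivAt (fun s => pmul m (F s)) (pmul m F') t := by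
  rw [hasDerivAt_iff_tendsto_slope] at hF ⊢
  refine (tendsto_const_pmul hm hF).congr fun s => ?_
  rw [slope_def_module, slope_def_module, pmul_smul hm, pmul_sub hm]

variable [IsFiniteMeasure μ]

theorem coeFn_one : one μ =ᵐ[μ] fun _ => (1 : ℂ) := Lp.coeFn_const 2 μ 1

theorem one_mem_supBall : one μ ∈ supBall μ 1 := by
  filter_upwards [coeFn_one (μ := μ)] with x hx
  simp [hx]

theorem one_mem_linf : one μ ∈ linf μ := linf_of_mem_supBall one_mem_supBall

theorem one_pmul (f : Lp ℂ 2 μ) : pmul (one μ) f = f := by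
  refine Lp.ext ?_
  filter_upwards [coeFn_pmul one_mem_linf f, coeFn_one (μ := μ)] with x h1 h2
  rw [h1, h2, one_mul]

theorem pmul_one (f : Lp ℂ 2 μ) : pmul f (one μ) = f := by
  rw [pmul_comm, one_pmul]

/-- The pointwise exponential of an element of `L₂`, with junk value `0`. -/
def pexp (f : Lp ℂ 2 μ) : Lp ℂ 2 μ :=
  open Classical in if h : MemLp (fun x => Complex.exp (f x)) 2 μ then h.toLp else 0

theorem coeFn_pexp {f : Lp ℂ 2 μ} (hf : f ∈ linf μ) :
    pexp f =ᵐ[μ] fun x => Complex.exp (f x) := by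
  obtain ⟨C, -, hC⟩ := exists_mem_supBall_of_linf hf
  have h : MemLp (fun x => Complex.exp (f x)) 2 μ := by
    refine MemLp.of_bound
      (Complex.continuous_exp.comp_aestronglyMeasurable (Lp.aestronglyMeasurable f))
      (Real.exp C) ?_
    filter_upwards [hC] with x hx
    exact (Complex.norm_exp_le_exp_norm _).trans (Real.exp_le_exp.2 hx)
  rw [pexp, dif_pos h]
  exact h.coeFn_toLp

theorem pexp_mem_supBall {f : Lp ℂ 2 μ} {C : ℝ} (hC : f ∈ supBall μ C) :
    pexp f ∈ supBall μ (Real.exp C) := by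
  filter_upwards [hC, coeFn_pexp (linf_of_mem_supBall hC)] with x hx h
  rw [h]
  exact (Complex.norm_exp_le_exp_norm _).trans (Real.exp_le_exp.2 hx)

/-- Differentiability in `L₂` alone would not control the exponential. The sup-norm Lipschitz bound
`hC` makes the second-order Taylor remainder `O((s - t)²)` uniformly in `x`; what is left is the
linear term `exp(F t) · F s`. -/
theorem hasDerivAt_pexp {F : ℝ → Lp ℂ 2 μ} {F' : Lp ℂ 2 μ} {t C : ℝ}
    (hF : HasDerivAt F F' t) (hC : ∀ s, F s - F t ∈ supBall μ (C * |s - t|))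
    (hFt : ∀ s, F s ∈ linf μ) :
    HasDerivAt (fun s => pexp (F s)) (pmul (pexp (F t)) F') t := by
  obtain ⟨M, hM0, hM⟩ := exists_mem_supBall_of_linf (hFt t)
  have hEM := pexp_mem_supBall hM
  have hEl := linf_of_mem_supBall hEM
  have hmain := hasDerivAt_const_pmul hEl hF
  have hrem : HasDerivAt (fun s => pexp (F s) - pmul (pexp (F t)) (F s)) 0 t := by
    rw [hasDerivAt_iff_isLittleO]
    set K : ℝ := Real.exp M * C ^ 2 * ‖one μ‖
    have hO : (fun s => (pexp (F s) - pmul (pexp (F t)) (F s))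
        - (pexp (F t) - pmul (pexp (F t)) (F t)) - (s - t) • (0 : Lp ℂ 2 μ)) =O[𝓝 t]
        fun s => (s - t) ^ 2 := by
      refine Asymptotics.IsBigO.of_bound K ?_
      have hsmall : ∀ᶠ s in 𝓝 t, C * |s - t| < 1 := by
        have : Tendsto (fun s => C * |s - t|) (𝓝 t) (𝓝 (C * |t - t|)) := by
          apply Continuous.tendsto; fun_prop
        simp only [sub_self, abs_zero, mul_zero] at this
        exact this.eventually_lt_const one_pos
      filter_upwards [hsmall] with s hs
      have : ‖pexp (F s) - pmul (pexp (F t)) (F s) - (pexp (F t) - pmul (pexp (F t)) (F t))‖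
          ≤ (Real.exp M * (C * |s - t|) ^ 2) * ‖one μ‖ := by
        refine Lp.norm_le_mul_norm_of_ae_le_mul ?_
        filter_upwards [coeFn_pexp (hFt s), coeFn_pexp (hFt t), coeFn_pmul hEl (F s),
          coeFn_pmul hEl (F t), hM, hC s, Lp.coeFn_sub (F s) (F t), coeFn_one (μ := μ),
          Lp.coeFn_sub (pexp (F s) - pmul (pexp (F t)) (F s))
            (pexp (F t) - pmul (pexp (F t)) (F t)),
          Lp.coeFn_sub (pexp (F s)) (pmul (pexp (F t)) (F s)),
          Lp.coeFn_sub (pexp (F t)) (pmul (pexp (F t)) (F t))] with x e1 e2 e3 e4 e5 e6 e7 e8 e9 e10 e11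
        rw [e9, Pi.sub_apply, e10, e11, Pi.sub_apply, Pi.sub_apply, e3, e4, e1, e2, e8]
        rw [e7, Pi.sub_apply] at e6
        have e : Complex.exp (F s x) - Complex.exp (F t x) * F s x
            - (Complex.exp (F t x) - Complex.exp (F t x) * F t x)
            = Complex.exp (F t x)
              * (Complex.exp (F s x - F t x) - 1 - (F s x - F t x)) := by
          rw [Complex.exp_sub]
          field_simp [Complex.exp_ne_zero]
          ring
        rw [e, norm_mul, norm_one, mul_one]
        refine mul_le_mul ((Complex.norm_exp_le_exp_norm _).trans (Real.exp_le_exp.2 e5)) ?_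
          (norm_nonneg _) (Real.exp_pos _).le
        refine (Complex.norm_exp_sub_one_sub_id_le (e6.trans hs.le)).trans ?_
        gcongr
      rw [smul_zero, sub_zero]
      refine this.trans (le_of_eq ?_)
      rw [mul_pow, sq_abs, Real.norm_eq_abs, abs_of_nonneg (sq_nonneg _)]
      ring
    refine hO.trans_isLittleO ?_
    simpa only [Real.norm_eq_abs, sq_abs] using Asymptotics.isLittleO_pow_sub_sub t (one_lt_two)
  have h := hrem.add hmain
  rw [zero_add] at h
  refine h.congr_of_eventuallyEq (Eventually.of_forall fun s => ?_)
  simp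

end Product

/-! ### Differential calculus of `C₀`-groups -/

section AbstractGroup

theorem eq_zero_of_norm_deriv_le {F : Type*} [NormedAddCommGroup F] [NormedSpace ℝ F]
    {S S' : ℝ → F} {K T : ℝ} (hS0 : S 0 = 0)
    (hS : ∀ s, HasDerivAt S (S' s) s) (hb : ∀ s ∈ Set.Icc 0 T, ‖S' s‖ ≤ K * ‖S s‖)
    (hT : 0 ≤ T) : S T = 0 := by
  have := norm_le_gronwallBound_of_norm_deriv_right_le (f := S) (f' := S') (δ := 0) (K := K)
    (ε := 0) (a := 0) (b := T) (fun s _ => (hS s).continuousAt.continuousWithinAt)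
    (fun s _ => (hS s).hasDerivWithinAt) (by simp [hS0])
    (fun s hs => by simpa using hb s ⟨hs.1, hs.2.le⟩) T ⟨hT, le_rfl⟩
  simpa [gronwallBound_ε0] using this

variable {E : Type*} [NormedAddCommGroup E] [NormedSpace ℂ E] {U : ℝ → E →L[ℂ] E}

theorem IsC0Group.apply_add (hU : IsC0Group U) (s t : ℝ) (f : E) : U (s + t) f = U s (U t f) := by
  rw [hU.map_add]
  rfl

theorem IsC0Group.apply_zero (hU : IsC0Group U) (f : E) : U 0 f = f := by
  rw [hU.map_zero]
  rfl

theorem IsC0Group.apply_apply_neg (hU : IsC0Group U) (t : ℝ) (f : E) : U t (U (-t) f) = f := by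
  rw [← hU.apply_add, add_neg_cancel, hU.apply_zero]

theorem IsC0Group.exists_norm_le [CompleteSpace E] (hU : IsC0Group U) (a b : ℝ) :
    ∃ M, 0 ≤ M ∧ ∀ s ∈ Set.Icc a b, ‖U s‖ ≤ M := by
  obtain ⟨M, hM⟩ := banach_steinhaus (g := fun s : Set.Icc a b => U s) fun f => by
    obtain ⟨C, hC⟩ := isCompact_Icc.exists_bound_of_continuousOn
      (hU.continuous_orbit f).continuousOn (s := Set.Icc a b)
    exact ⟨C, fun s => hC s s.2⟩
  exact ⟨max M 0, le_max_right _ _, fun s hs => (hM ⟨s, hs⟩).trans (le_max_left _ _)⟩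

/-- A `C₀`-group is jointly continuous. -/
theorem IsC0Group.tendsto_apply [CompleteSpace E] (hU : IsC0Group U) {ι : Type*} {l : Filter ι}
    {s : ι → ℝ} {f : ι → E} {t : ℝ} {f₀ : E} (hs : Tendsto s l (𝓝 t)) (hf : Tendsto f l (𝓝 f₀)) :
    Tendsto (fun i => U (s i) (f i)) l (𝓝 (U t f₀)) := by
  obtain ⟨M, -, hM⟩ := hU.exists_norm_le (t - 1) (t + 1)
  have h1 : Tendsto (fun i => U (s i) (f i - f₀)) l (𝓝 0) := by
    have hlim : Tendsto (fun i => M * ‖f i - f₀‖) l (𝓝 0) := by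
      simpa using (tendsto_iff_norm_sub_tendsto_zero.1 hf).const_mul M
    refine squeeze_zero_norm' ?_ hlim
    filter_upwards [hs.eventually (Icc_mem_nhds (sub_one_lt t) (lt_add_one t))] with i hi
    exact (U (s i)).le_of_opNorm_le (hM _ hi) _
  have h2 : Tendsto (fun i => U (s i) f₀) l (𝓝 (U t f₀)) :=
    ((hU.continuous_orbit f₀).tendsto t).comp hs
  simpa using h1.add h2

variable [NormedSpace ℝ E]

theorem IsC0Group.hasDerivAt_integral [CompleteSpace E] (hU : IsC0Group U) (f : E) (u : ℝ) :
    HasDerivAt (fun u => ∫ s in (0 : ℝ)..u, U s f) (U u f) u :=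
  ((hU.continuous_orbit f).integral_hasStrictDerivAt 0 u).hasDerivAt

theorem IsC0Group.tendsto_average [CompleteSpace E] (hU : IsC0Group U) (f : E) :
    Tendsto (fun d : ℝ => d⁻¹ • ∫ s in (0 : ℝ)..d, U s f) (𝓝[≠] 0) (𝓝 f) := by
  have h := hU.hasDerivAt_integral f 0
  rw [hasDerivAt_iff_tendsto_slope_zero, hU.apply_zero] at h
  simpa using h

variable [IsScalarTower ℝ ℂ E]

theorem IsC0Group.hasOrbitDeriv_iff (hU : IsC0Group U) {f g : E} :
    HasOrbitDeriv U f g ↔ HasDerivAt (fun t => U t f) g 0 := by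
  rw [hasDerivAt_iff_tendsto_slope_zero, HasOrbitDeriv]
  simp only [zero_add, hU.apply_zero]
  refine tendsto_congr fun t => ?_
  rw [← Complex.ofReal_inv, ← algebraMap_smul ℂ (t⁻¹) (U t f - f)]
  rfl

theorem IsC0Group.map_real_smul (t c : ℝ) (f : E) : U t (c • f) = c • U t f := by
  rw [← algebraMap_smul ℂ c f, map_smul, algebraMap_smul]

theorem IsC0Group.hasDerivAt (hU : IsC0Group U) {f g : E} (h : HasOrbitDeriv U f g) (t : ℝ) :
    HasDerivAt (fun s => U s f) (U t g) t := by
  rw [hU.hasOrbitDeriv_iff, hasDerivAt_iff_tendsto_slope_zero] at h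
  rw [hasDerivAt_iff_tendsto_slope_zero]
  refine (((U t).continuous.tendsto g).comp h).congr fun s => ?_
  simp only [Function.comp, zero_add, hU.apply_zero, map_real_smul, map_sub, hU.apply_add]

theorem IsC0Group.hasOrbitDeriv_apply (hU : IsC0Group U) {f g : E} (h : HasOrbitDeriv U f g)
    (t : ℝ) : HasOrbitDeriv U (U t f) (U t g) := by
  rw [hU.hasOrbitDeriv_iff]
  have := (hU.hasDerivAt h (0 + t)).comp_add_const 0 t
  simpa only [zero_add, hU.apply_add] using this

variable [CompleteSpace E]

/-- `U_t` only shifts the interval of integration, to `[t, t + d]`, so the fundamental theorem of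
calculus applies at both ends. Averages of orbits thus lie in `D(A)`. -/
theorem IsC0Group.hasOrbitDeriv_integral (hU : IsC0Group U) (f : E) (d : ℝ) :
    HasOrbitDeriv U (∫ s in (0 : ℝ)..d, U s f) (U d f - f) := by
  rw [hU.hasOrbitDeriv_iff]
  have hc := hU.continuous_orbit f
  have e : ∀ t, U t (∫ s in (0 : ℝ)..d, U s f)
      = (∫ s in (0 : ℝ)..(t + d), U s f) - ∫ s in (0 : ℝ)..t, U s f := by
    intro t
    rw [intervalIntegral.integral_interval_sub_left (hc.intervalIntegrable _ _)
      (hc.intervalIntegrable _ _), ← ContinuousLinearMap.intervalIntegral_comp_comm _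
      (hc.intervalIntegrable _ _)]
    simp only [← hU.apply_add]
    rw [intervalIntegral.integral_comp_add_left (fun s => U s f) t, add_zero]
  simp only [e]
  have h1 := (hU.hasDerivAt_integral f (0 + d)).comp_add_const 0 d
  have h2 := hU.hasDerivAt_integral f 0
  have := h1.sub h2
  rwa [zero_add, hU.apply_zero] at this

/-- Variation of constants: hypothesis `hA` says `R' = A R + L` at `s`, and the factor `U (-s)`
cancels the term `A R`. -/
theorem IsC0Group.hasDerivAt_neg_apply (hU : IsC0Group U) {R : ℝ → E} {R' L : E} {s : ℝ}
    (hR : HasDerivAt R R' s) (hA : HasOrbitDeriv U (R s) (R' - L)) :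
    HasDerivAt (fun r => U (-r) (R r)) (U (-s) L) s := by
  have h1 : Tendsto (fun r => U (-r) (slope R s r)) (𝓝[≠] s) (𝓝 (U (-s) R')) :=
    hU.tendsto_apply (continuous_neg.tendsto s |>.mono_left nhdsWithin_le_nhds)
      (hasDerivAt_iff_tendsto_slope.1 hR)
  have h2 : HasDerivAt (fun r => U (-r) (R s)) (-(U (-s) (R' - L))) s := by
    exact ((hU.hasDerivAt hA (-s)).scomp s (hasDerivAt_neg s)).congr_deriv (by simp)
  rw [hasDerivAt_iff_tendsto_slope] at h2 ⊢
  have e : U (-s) R' + -(U (-s) (R' - L)) = U (-s) L := by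
    rw [map_sub]
    abel
  rw [← e]
  refine (h1.add h2).congr fun r => ?_
  rw [slope_def_module, slope_def_module, slope_def_module, map_real_smul, ← smul_add, map_sub]
  congr 1
  abel

/-- A solution of `R' = A R + L`, where `L` is dominated by `R`, vanishes if it vanishes at `0`. -/
theorem IsC0Group.eq_zero_of_deriv (hU : IsC0Group U) {R R' L : ℝ → E} {c : ℝ} (hR0 : R 0 = 0)
    (hR : ∀ s, HasDerivAt R (R' s) s) (hA : ∀ s, HasOrbitDeriv U (R s) (R' s - L s))
    (hL : ∀ s, ‖L s‖ ≤ c * ‖R s‖) (t : ℝ) : R t = 0 := by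
  have hc : ∀ s, ‖L s‖ ≤ |c| * ‖R s‖ := fun s => (hL s).trans (by gcongr; exact le_abs_self c)
  obtain ⟨M, hM0, hM⟩ := hU.exists_norm_le (-|t|) |t|
  have hS := fun s => hU.hasDerivAt_neg_apply (hR s) (hA s)
  -- One factor `M` bounds `U (-s)`; the other recovers `R s` as `U s` applied to `U (-s) (R s)`.
  have hbound : ∀ s, |s| ≤ |t| → ‖U (-s) (L s)‖ ≤ M * |c| * M * ‖U (-s) (R s)‖ := by
    intro s hs
    have h1 := (U (-s)).le_of_opNorm_le (hM (-s) (abs_le.1 (by rwa [abs_neg]))) (L s)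
    have h2 := (U s).le_of_opNorm_le (hM s (abs_le.1 hs)) (U (-s) (R s))
    rw [hU.apply_apply_neg] at h2
    calc _ ≤ M * (|c| * ‖R s‖) := h1.trans (by gcongr; exact hc s)
      _ ≤ M * (|c| * (M * ‖U (-s) (R s)‖)) := by gcongr
      _ = _ := by ring
  have h0 : U (-0) (R 0) = 0 := by rw [hR0, _root_.map_zero]
  suffices h : U (-t) (R t) = 0 by
    rw [← hU.apply_apply_neg t (R t), h, _root_.map_zero]
  rcases le_total 0 t with ht | ht
  · refine eq_zero_of_norm_deriv_le (S := fun r => U (-r) (R r)) h0 hS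
      (fun s hs => hbound s ?_) ht
    rw [abs_of_nonneg hs.1, abs_of_nonneg ht]
    exact hs.2
  -- Gronwall runs forward in time, so negative `t` is handled by reflection.
  · have hneg : ∀ s, HasDerivAt (fun r => U (-(-r)) (R (-r))) (-(U (-(-s)) (L (-s)))) s := by
      intro s
      exact ((hS (-s)).scomp s (hasDerivAt_neg s)).congr_deriv (by simp)
    have := eq_zero_of_norm_deriv_le (S := fun r => U (-(-r)) (R (-r)))
      (K := M * |c| * M) (T := -t) (by simpa using h0) hneg
      (fun s hs => by
        rw [norm_neg]
        refine hbound (-s) ?_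
        rw [abs_neg, abs_of_nonneg hs.1, abs_of_nonpos ht]
        exact hs.2) (by linarith)
    simpa using this

end AbstractGroup

/-! ### From the product rule to multiplicativity up to a weight -/

section Multiplicativity

variable {X : Type*} [MeasurableSpace X] {μ : Measure X}

theorem ae_norm_le_norm_top (f : Lp ℂ ∞ μ) : ∀ᵐ x ∂μ, ‖f x‖ ≤ ‖f‖ := by
  have hfin := Lp.eLpNorm_ne_top f
  rw [eLpNorm_exponent_top] at hfin
  rw [Lp.norm_def, eLpNorm_exponent_top]
  filter_upwards [ae_le_eLpNormEssSup (f := f) (μ := μ)] with x hx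
  simpa using ENNReal.toReal_mono hfin hx

/-- A bounded element of `L₂`, as an element of `L_∞`. -/
def twoToTop (f : Lp ℂ 2 μ) (hf : f ∈ linf μ) : Lp ℂ ∞ μ := MemLp.toLp f (mem_linf.1 hf)

theorem coeFn_twoToTop {f : Lp ℂ 2 μ} (hf : f ∈ linf μ) : twoToTop f hf =ᵐ[μ] f :=
  MemLp.coeFn_toLp (mem_linf.1 hf)

variable [IsProbabilityMeasure μ]

theorem norm_le_of_ae_norm_le {p : ℝ≥0∞} {f : Lp ℂ p μ} {C : ℝ} (hC : 0 ≤ C)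
    (h : ∀ᵐ x ∂μ, ‖f x‖ ≤ C) : ‖f‖ ≤ C := by
  have hu : measureUnivNNReal μ = 1 := by simp [measureUnivNNReal]
  simpa [hu] using Lp.norm_le_of_ae_bound hC h

/-- The inclusion of `L_∞` in `L₂`. -/
def topToTwo (μ : Measure X) [IsProbabilityMeasure μ] : Lp ℂ ∞ μ →L[ℂ] Lp ℂ 2 μ :=
  LinearMap.mkContinuous
    { toFun := fun f => ((Lp.memLp f).mono_exponent le_top).toLp
      map_add' := fun f g => by
        rw [← MemLp.toLp_add, MemLp.toLp_eq_toLp_iff]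
        exact Lp.coeFn_add f g
      map_smul' := fun c f => by
        rw [RingHom.id_apply, ← MemLp.toLp_const_smul, MemLp.toLp_eq_toLp_iff]
        exact Lp.coeFn_smul c f } 1 fun f => by
    rw [one_mul]
    refine norm_le_of_ae_norm_le (norm_nonneg _) ?_
    filter_upwards [MemLp.coeFn_toLp ((Lp.memLp f).mono_exponent (p := 2) le_top),
      ae_norm_le_norm_top f] with x h1 h2
    rw [LinearMap.coe_mk, AddHom.coe_mk, h1]
    exact h2

theorem coeFn_topToTwo (f : Lp ℂ ∞ μ) : topToTwo μ f =ᵐ[μ] f :=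
  MemLp.coeFn_toLp ((Lp.memLp f).mono_exponent le_top)

theorem topToTwo_mem_linf (f : Lp ℂ ∞ μ) : topToTwo μ f ∈ linf μ :=
  mem_linf.2 ((Lp.memLp f).ae_eq (coeFn_topToTwo f).symm)

theorem topToTwo_injective : Function.Injective (topToTwo μ) := fun f g h => Lp.ext <|
  (coeFn_topToTwo f).symm.trans (by rw [h]; exact coeFn_topToTwo g)

theorem topToTwo_twoToTop {f : Lp ℂ 2 μ} (hf : f ∈ linf μ) : topToTwo μ (twoToTop f hf) = f :=
  Lp.ext ((coeFn_topToTwo _).trans (coeFn_twoToTop hf))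

/-- An operator on `L₂` that leaves `L_∞` invariant is bounded on `L_∞`. -/
theorem exists_mapsTo_supBall (V : Lp ℂ 2 μ →L[ℂ] Lp ℂ 2 μ) (hV : ∀ f ∈ linf μ, V f ∈ linf μ)
    {r : ℝ} (hr : 0 ≤ r) : ∃ C, ∀ f ∈ supBall μ r, V f ∈ supBall μ C := by
  let W : Lp ℂ ∞ μ →ₗ[ℂ] Lp ℂ ∞ μ :=
    { toFun := fun f => twoToTop _ (hV _ (topToTwo_mem_linf f))
      map_add' := fun f g => topToTwo_injective (by simp only [map_add, topToTwo_twoToTop])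
      map_smul' := fun c f => topToTwo_injective (by
        simp only [map_smul, topToTwo_twoToTop, RingHom.id_apply]) }
  have hW : ∀ f, topToTwo μ (W f) = V (topToTwo μ f) := fun f =>
    topToTwo_twoToTop (hV _ (topToTwo_mem_linf f))
  -- Closed graph theorem: an `L_∞`-limit is also an `L₂`-limit, where `V` is already continuous,
  -- and the inclusion is injective.
  have hWc : Continuous W := by
    refine W.continuous_of_seq_closed_graph fun u x y hu hWu => topToTwo_injective ?_
    rw [hW]
    have h1 : Tendsto (fun n => V (topToTwo μ (u n))) atTop (𝓝 (V (topToTwo μ x))) :=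
      ((V.continuous.comp (topToTwo μ).continuous).tendsto x).comp hu
    have h2 : Tendsto (fun n => topToTwo μ (W (u n))) atTop (𝓝 (topToTwo μ y)) :=
      ((topToTwo μ).continuous.tendsto y).comp hWu
    simp only [hW] at h2
    exact tendsto_nhds_unique h2 h1
  let W' : Lp ℂ ∞ μ →L[ℂ] Lp ℂ ∞ μ := ⟨W, hWc⟩
  refine ⟨‖W'‖ * r, fun f hf => ?_⟩
  have hfl := linf_of_mem_supBall hf
  set F : Lp ℂ ∞ μ := twoToTop f hfl
  have hFn : ‖F‖ ≤ r := by
    refine norm_le_of_ae_norm_le hr ?_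
    filter_upwards [hf, coeFn_twoToTop hfl] with x h1 h2
    rw [h2]
    exact h1
  have hVF : V f = topToTwo μ (W F) := by
    rw [hW, topToTwo_twoToTop hfl]
  have hWF : ‖W F‖ ≤ ‖W'‖ * r := (W'.le_opNorm F).trans (by gcongr)
  rw [hVF]
  filter_upwards [coeFn_topToTwo (W F), ae_norm_le_norm_top (W F)] with x h1 h2
  rw [h1]
  exact h2.trans hWF

variable {U : ℝ → Lp ℂ 2 μ →L[ℂ] Lp ℂ 2 μ}

/-- Orbits of bounded functions are locally bounded in `L_∞`. -/
theorem IsC0Group.eventually_mem_supBall (hU : IsC0Group U)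
    (hinv : ∀ t : ℝ, ∀ f ∈ linf μ, U t f ∈ linf μ) {f : Lp ℂ 2 μ} (hf : f ∈ linf μ) (t : ℝ) :
    ∃ C, ∀ᶠ s in 𝓝 t, U s f ∈ supBall μ C := by
  -- Baire: the closed sets of times at which the orbit is bounded by `n` cover the line, so one of
  -- them has an interior point `s₀`.
  obtain ⟨n, s₀, hs₀⟩ := nonempty_interior_of_iUnion_of_closed
    (f := fun n : ℕ => {s | U s f ∈ supBall μ n})
    (fun n => (isClosed_supBall _).preimage (hU.continuous_orbit f)) (by
      refine Set.eq_univ_of_forall fun s => Set.mem_iUnion.2 ?_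
      obtain ⟨C, -, hC⟩ := exists_mem_supBall_of_linf (hinv s f hf)
      obtain ⟨n, hn⟩ := exists_nat_ge C
      exact ⟨n, supBall_mono hn hC⟩)
  -- The operator `U (t - s₀)`, bounded on `L_∞`, moves the bound from near `s₀` to near `t`.
  obtain ⟨C, hC⟩ := exists_mapsTo_supBall (U (t - s₀)) (hinv _) n.cast_nonneg
  refine ⟨C, ?_⟩
  have hlim : Tendsto (fun s => s - (t - s₀)) (𝓝 t) (𝓝 s₀) := by
    have : Tendsto (fun s => s - (t - s₀)) (𝓝 t) (𝓝 (t - (t - s₀))) :=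
      Continuous.tendsto (by fun_prop) t
    rwa [sub_sub_cancel] at this
  filter_upwards [hlim.eventually (mem_interior_iff_mem_nhds.1 hs₀)] with s hs
  have := hC _ hs
  rwa [← hU.apply_add, add_sub_cancel] at this

/-- The product rule satisfied by the generator `A` of a weighted Koopman group, `a = A 𝟙`. -/
def IsLeibniz (U : ℝ → Lp ℂ 2 μ →L[ℂ] Lp ℂ 2 μ) (a : Lp ℂ 2 μ) : Prop :=
  ∀ f ∈ linf μ, ∀ g ∈ linf μ, ∀ f' g', HasOrbitDeriv U f f' → HasOrbitDeriv U g g' →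
    HasOrbitDeriv U (pmul f g) (pmul f g' + pmul f' g - pmul a (pmul f g))

/-- Multiplicativity up to a weight: `U_t (f g) · U_t 𝟙 = U_t f · U_t g` for bounded `f`, `g`. -/
def IsWeightedMul (U : ℝ → Lp ℂ 2 μ →L[ℂ] Lp ℂ 2 μ) : Prop :=
  ∀ t, ∀ f ∈ linf μ, ∀ g ∈ linf μ, pmul (U t (pmul f g)) (U t (one μ)) = pmul (U t f) (U t g)

/-- By the ordinary product rule in `s` and the Leibniz rule for `A`, any product `P s = U_s p · U_s
q` satisfies `P' = A P + a P`. Both sides are of this form and agree at `s = 0`, so uniqueness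
applies to their difference. -/
theorem IsC0Group.mul_of_hasOrbitDeriv (hU : IsC0Group U)
    (hinv : ∀ t : ℝ, ∀ f ∈ linf μ, U t f ∈ linf μ) {a : Lp ℂ 2 μ} (ha : a ∈ linf μ)
    (h1 : HasOrbitDeriv U (one μ) a) (hL : IsLeibniz U a) {f g f' g' : Lp ℂ 2 μ}
    (hf : f ∈ linf μ) (hg : g ∈ linf μ) (hff : HasOrbitDeriv U f f') (hgg : HasOrbitDeriv U g g')
    (t : ℝ) : pmul (U t (pmul f g)) (U t (one μ)) = pmul (U t f) (U t g) := by
  have key : ∀ {p q p' q' : Lp ℂ 2 μ}, p ∈ linf μ → q ∈ linf μ → HasOrbitDeriv U p p' →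
      HasOrbitDeriv U q q' → ∀ s,
      HasDerivAt (fun s => pmul (U s p) (U s q)) (pmul (U s p) (U s q') + pmul (U s p') (U s q)) s ∧
      HasOrbitDeriv U (pmul (U s p) (U s q)) (pmul (U s p) (U s q') + pmul (U s p') (U s q)
        - pmul a (pmul (U s p) (U s q))) := by
    intro p q p' q' hp hq hpp hqq s
    obtain ⟨C, hC⟩ := hU.eventually_mem_supBall hinv hp s
    exact ⟨hasDerivAt_pmul (hU.hasDerivAt hpp s) (hU.hasDerivAt hqq s) hC (hinv s q hq),
      hL _ (hinv s p hp) _ (hinv s q hq) _ _ (hU.hasOrbitDeriv_apply hpp s)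
        (hU.hasOrbitDeriv_apply hqq s)⟩
  have k1 := key (pmul_mem_linf hf hg) one_mem_linf (hL f hf g hg _ _ hff hgg) h1
  have k2 := key hf hg hff hgg
  obtain ⟨c, -, hc⟩ := exists_mem_supBall_of_linf ha
  refine sub_eq_zero.1 (hU.eq_zero_of_deriv (c := c)
    (R := fun s => pmul (U s (pmul f g)) (U s (one μ)) - pmul (U s f) (U s g))
    (L := fun s => pmul a (pmul (U s (pmul f g)) (U s (one μ)) - pmul (U s f) (U s g)))
    ?_ (fun s => (k1 s).1.sub (k2 s).1) (fun s => ?_) (fun s => norm_pmul_le hc _) t)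
  · simp only [hU.apply_zero, pmul_one, sub_self]
  · have h := (k1 s).2.add ((k2 s).2.smul (-1))
    rw [neg_one_smul, neg_one_smul] at h
    rw [pmul_sub ha]
    convert h using 1 <;> abel

/-- Density of `D(A)` in `L₂` is not enough: the approximants must stay bounded in `L_∞`. Averages
of the orbit over `[0, d]` do, since bounded orbits are locally bounded in `L_∞`. -/
theorem IsC0Group.isWeightedMul_of_isLeibniz (hU : IsC0Group U)
    (hinv : ∀ t : ℝ, ∀ f ∈ linf μ, U t f ∈ linf μ) {a : Lp ℂ 2 μ} (ha : a ∈ linf μ)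
    (h1 : HasOrbitDeriv U (one μ) a) (hL : IsLeibniz U a) : IsWeightedMul U := by
  intro t f hf g hg
  let av : Lp ℂ 2 μ → ℝ → Lp ℂ 2 μ := fun f d => d⁻¹ • ∫ s in (0 : ℝ)..d, U s f
  have hav : ∀ f d, ∃ f', HasOrbitDeriv U (av f d) f' := by
    intro f d
    have := (hU.hasOrbitDeriv_integral f d).smul ((d⁻¹ : ℝ) : ℂ)
    rw [Complex.coe_smul] at this
    exact ⟨_, this⟩
  have hbd : ∀ f ∈ linf μ, ∃ C, ∀ᶠ d in 𝓝[≠] (0 : ℝ), av f d ∈ supBall μ C := by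
    intro f hf
    obtain ⟨C, hC⟩ := hU.eventually_mem_supBall hinv hf 0
    obtain ⟨ε, hε, hball⟩ := Metric.eventually_nhds_iff_ball.1 hC
    refine ⟨C, ?_⟩
    filter_upwards [nhdsWithin_le_nhds (Metric.ball_mem_nhds 0 hε), self_mem_nhdsWithin] with d hd hd0
    have hint := integral_mem_supBall (hU.continuous_orbit f) (C := C) (a := 0) (b := d)
      fun r hr => hball r ((convex_ball (0 : ℝ) ε).ordConnected.uIcc_subset
        (Metric.mem_ball_self hε) hd hr)
    have := supBall_smul_mem hint d⁻¹
    have hd1 : |d| ≠ 0 := abs_ne_zero.2 hd0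
    rwa [sub_zero, abs_inv, mul_left_comm, inv_mul_cancel₀ hd1, mul_one] at this
  obtain ⟨C, hC⟩ := hbd f hf
  obtain ⟨D, hD⟩ := hbd g hg
  have hfl := hU.tendsto_average f
  have hgl := hU.tendsto_average g
  -- The product of the images also needs a uniform sup-norm bound, supplied by the boundedness of
  -- `U t` on `L_∞`.
  obtain ⟨K, hK⟩ := exists_mapsTo_supBall (U t) (hinv t) (abs_nonneg C)
  have hl := tendsto_const_pmul (hinv t _ one_mem_linf)
    (((U t).continuous.tendsto _).comp (tendsto_pmul hfl hgl hC))
  have hr := tendsto_pmul (((U t).continuous.tendsto _).comp hfl)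
    (((U t).continuous.tendsto _).comp hgl)
    (hC.mono fun d hd => hK _ (supBall_mono (le_abs_self C) hd))
  rw [pmul_comm]
  refine tendsto_nhds_unique (hl.congr' ?_) hr
  filter_upwards [hC, hD] with d hd1 hd2
  obtain ⟨f', hf'⟩ := hav f d
  obtain ⟨g', hg'⟩ := hav g d
  rw [pmul_comm]
  exact hU.mul_of_hasOrbitDeriv hinv ha h1 hL (linf_of_mem_supBall hd1) (linf_of_mem_supBall hd2)
    hf' hg' t

end Multiplicativity

/-! ### Realizing multiplicative operators by point maps -/

section PointRealization

variable {X : Type*} [MeasurableSpace X] {μ : Measure X} [IsProbabilityMeasure μ]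

/-- The indicator function of a measurable set, as an element of `L₂`. -/
def ind (μ : Measure X) [IsProbabilityMeasure μ] {s : Set X} (hs : MeasurableSet s) : Lp ℂ 2 μ :=
  indicatorConstLp 2 hs (measure_ne_top μ s) 1

theorem coeFn_ind {s : Set X} (hs : MeasurableSet s) :
    ind μ hs =ᵐ[μ] s.indicator fun _ => (1 : ℂ) := indicatorConstLp_coeFn

theorem ind_mem_supBall {s : Set X} (hs : MeasurableSet s) : ind μ hs ∈ supBall μ 1 := by
  filter_upwards [coeFn_ind (μ := μ) hs] with x hx
  rw [hx]
  by_cases h : x ∈ s <;> simp [h]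

theorem ind_mem_linf {s : Set X} (hs : MeasurableSet s) : ind μ hs ∈ linf μ :=
  linf_of_mem_supBall (ind_mem_supBall hs)

theorem ind_compl {s : Set X} (hs : MeasurableSet s) : ind μ hs.compl = one μ - ind μ hs := by
  refine Lp.ext ?_
  filter_upwards [coeFn_ind (μ := μ) hs, coeFn_ind (μ := μ) hs.compl, coeFn_one (μ := μ),
    Lp.coeFn_sub (one μ) (ind μ hs)] with x h1 h2 h3 h4
  rw [h4, Pi.sub_apply, h1, h2, h3]
  by_cases h : x ∈ s <;> simp [h]

theorem ind_inter {s t : Set X} (hs : MeasurableSet s) (ht : MeasurableSet t) :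
    ind μ (hs.inter ht) = pmul (ind μ hs) (ind μ ht) := by
  refine Lp.ext ?_
  filter_upwards [coeFn_ind (μ := μ) hs, coeFn_ind (μ := μ) ht, coeFn_ind (μ := μ) (hs.inter ht),
    coeFn_pmul (ind_mem_linf (μ := μ) hs) (ind μ ht)] with x h1 h2 h3 h4
  rw [h4, h1, h2, h3]
  by_cases h : x ∈ s <;> by_cases h' : x ∈ t <;> simp [h, h']

/-- `V` maps the indicator function of `E` to that of `F`. -/
def MapsInd (V : Lp ℂ 2 μ →L[ℂ] Lp ℂ 2 μ) (E F : Set X) : Prop :=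
  ∃ hE : MeasurableSet E, V (ind μ hE) =ᵐ[μ] F.indicator fun _ => (1 : ℂ)

variable {V : Lp ℂ 2 μ →L[ℂ] Lp ℂ 2 μ}

theorem MapsInd.compl (hone : V (one μ) = one μ) {E F : Set X} (h : MapsInd V E F) :
    MapsInd V Eᶜ Fᶜ := by
  obtain ⟨hE, h⟩ := h
  refine ⟨hE.compl, ?_⟩
  rw [ind_compl hE, map_sub, hone]
  filter_upwards [h, coeFn_one (μ := μ), Lp.coeFn_sub (one μ) (V (ind μ hE))] with x h1 h2 h3
  rw [h3, Pi.sub_apply, h1, h2]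
  by_cases h : x ∈ F <;> simp [h]

theorem MapsInd.inter (hinv : ∀ f ∈ linf μ, V f ∈ linf μ)
    (hmul : ∀ f ∈ linf μ, ∀ g ∈ linf μ, V (pmul f g) = pmul (V f) (V g)) {E F E' F' : Set X}
    (h : MapsInd V E F) (h' : MapsInd V E' F') : MapsInd V (E ∩ E') (F ∩ F') := by
  obtain ⟨hE, h⟩ := h
  obtain ⟨hE', h'⟩ := h'
  refine ⟨hE.inter hE', ?_⟩
  rw [ind_inter hE hE', hmul _ (ind_mem_linf hE) _ (ind_mem_linf hE')]
  filter_upwards [h, h', coeFn_pmul (hinv _ (ind_mem_linf hE)) (V (ind μ hE'))] with x h1 h2 h3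
  rw [h3, h1, h2]
  by_cases h : x ∈ F <;> by_cases h' : x ∈ F' <;> simp [h, h']

theorem MapsInd.union (hone : V (one μ) = one μ) (hinv : ∀ f ∈ linf μ, V f ∈ linf μ)
    (hmul : ∀ f ∈ linf μ, ∀ g ∈ linf μ, V (pmul f g) = pmul (V f) (V g)) {E F E' F' : Set X}
    (h : MapsInd V E F) (h' : MapsInd V E' F') : MapsInd V (E ∪ E') (F ∪ F') := by
  have := ((h.compl hone).inter hinv hmul (h'.compl hone)).compl hone
  simpa only [Set.compl_inter, compl_compl] using this

/-- Indicators of an increasing union converge in `L₂`, `V` is `L₂`-continuous, and a subsequence of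
the images converges a.e.; the sets `F n` need not be measurable. -/
theorem MapsInd.iUnion_of_monotone {E F : ℕ → Set X} (hE : Monotone E) (hF : Monotone F)
    (h : ∀ n, MapsInd V (E n) (F n)) : MapsInd V (⋃ n, E n) (⋃ n, F n) := by
  choose hEm h using h
  have hU := MeasurableSet.iUnion hEm
  refine ⟨hU, ?_⟩
  have hlim : Tendsto (fun n => ind μ (hEm n)) atTop (𝓝 (ind μ hU)) := by
    refine tendsto_indicatorConstLp_set (by simp) ?_
    have h0 := tendsto_measure_iInter_atTop (μ := μ) (s := fun n => (⋃ k, E k) \ E n)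
      (fun n => (hU.diff (hEm n)).nullMeasurableSet)
      (fun m n hmn => Set.sdiff_subset_sdiff_right (hE hmn)) ⟨0, measure_ne_top _ _⟩
    rw [← Set.sdiff_iUnion, Set.sdiff_self, measure_empty] at h0
    refine h0.congr fun n => ?_
    rw [Function.comp, symmDiff_of_le (Set.subset_iUnion E n)]
  obtain ⟨ns, hns, hae⟩ := (tendstoInMeasure_of_tendsto_Lp
    ((V.continuous.tendsto _).comp hlim)).exists_seq_tendsto_ae
  filter_upwards [hae, ae_all_iff.2 h] with x h1 h2
  refine tendsto_nhds_unique h1 ?_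
  have h3 := ((hF.tendsto_indicator F (fun _ => (1 : ℂ)) x).mono_right (pure_le_nhds _)).comp
    hns.tendsto_atTop
  refine h3.congr fun n => ?_
  simp only [Function.comp, h2]

theorem MapsInd.iUnion (hone : V (one μ) = one μ) (hinv : ∀ f ∈ linf μ, V f ∈ linf μ)
    (hmul : ∀ f ∈ linf μ, ∀ g ∈ linf μ, V (pmul f g) = pmul (V f) (V g)) {E F : ℕ → Set X}
    (h : ∀ n, MapsInd V (E n) (F n)) : MapsInd V (⋃ n, E n) (⋃ n, F n) := by
  rw [← Set.iUnion_accumulate (s := E), ← Set.iUnion_accumulate (s := F)]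
  refine MapsInd.iUnion_of_monotone Set.monotone_accumulate Set.monotone_accumulate fun n => ?_
  induction n with
  | zero => simpa only [Set.accumulate_zero_nat] using h 0
  | succ n ih =>
    rw [Set.accumulate_succ, Set.accumulate_succ]
    exact ih.union hone hinv hmul (h (n + 1))

/-- The image of an indicator is idempotent, hence takes only the values `0` and `1` a.e. -/
theorem exists_mapsInd (hinv : ∀ f ∈ linf μ, V f ∈ linf μ)
    (hmul : ∀ f ∈ linf μ, ∀ g ∈ linf μ, V (pmul f g) = pmul (V f) (V g)) {E : Set X}
    (hE : MeasurableSet E) : ∃ F, MapsInd V E F := by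
  refine ⟨{x | V (ind μ hE) x = 1}, hE, ?_⟩
  have h : V (ind μ hE) = pmul (V (ind μ hE)) (V (ind μ hE)) := by
    rw [← hmul _ (ind_mem_linf hE) _ (ind_mem_linf hE), ← ind_inter hE hE]
    congr 2
    exact (Set.inter_self E).symm
  have hc := coeFn_pmul (hinv _ (ind_mem_linf hE)) (V (ind μ hE))
  rw [← h] at hc
  filter_upwards [hc] with x hx
  by_cases h1 : V (ind μ hE) x = 1
  · simp [h1]
  · rw [Set.indicator_of_notMem (by exact h1)]
    by_contra h0
    exact h1 (mul_left_cancel₀ h0 (by rw [mul_one]; exact hx.symm))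

/-- On a standard Borel space, a bounded operator on `L₂` that restricts to a unital multiplicative
map of `L_∞` acts on indicator functions by a point map. -/
theorem exists_mapsInd_preimage [StandardBorelSpace X] (hone : V (one μ) = one μ)
    (hinv : ∀ f ∈ linf μ, V f ∈ linf μ)
    (hmul : ∀ f ∈ linf μ, ∀ g ∈ linf μ, V (pmul f g) = pmul (V f) (V g)) :
    ∃ T : X → X, ∀ E, ∀ hE : MeasurableSet E,
      V (ind μ hE) =ᵐ[μ] (T ⁻¹' E).indicator fun _ => (1 : ℂ) := by
  obtain ⟨φ, hφm, hφi⟩ := MeasurableSpace.measurable_injection_nat_bool_of_countablySeparated X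
  have hφ : MeasurableEmbedding φ := hφm.measurableEmbedding hφi
  have hEm : ∀ n, MeasurableSet {x | φ x n = true} := fun n =>
    (measurable_pi_iff.1 hφm n) (measurableSet_singleton true)
  choose F hF using fun n => exists_mapsInd hinv hmul (hEm n)
  classical
  -- With `X` embedded in Cantor space by `φ`, the sought map must satisfy `φ ∘ T = τ` a.e.: the
  -- `n`-th digit of `T x` is read off from the image of the `n`-th coordinate set.
  let τ : X → ℕ → Bool := fun x n => decide (x ∈ F n)
  have hpre : ∀ B : Set (ℕ → Bool), MeasurableSet B → MapsInd V (φ ⁻¹' B) (τ ⁻¹' B) := by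
    -- The sets `B` with the desired property form a σ-algebra; it contains the coordinate cylinders
    -- by the choice of `τ`, hence all measurable sets.
    let m : MeasurableSpace (ℕ → Bool) :=
      { MeasurableSet' := fun B => MapsInd V (φ ⁻¹' B) (τ ⁻¹' B)
        measurableSet_empty := by
          refine ⟨MeasurableSet.empty, ?_⟩
          have : ind μ (MeasurableSet.empty : MeasurableSet (∅ : Set X)) = 0 := indicatorConstLp_empty
          simp only [Set.preimage_empty, this, map_zero, Set.indicator_empty]
          exact Lp.coeFn_zero ℂ 2 μ
        measurableSet_compl := fun B hB => hB.compl hone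
        measurableSet_iUnion := fun B hB => by
          simp only [Set.preimage_iUnion]
          exact MapsInd.iUnion hone hinv hmul hB }
    have hle : MeasurableSpace.pi ≤ m := by
      refine iSup_le fun n => measurable_iff_comap_le.1 ?_
      refine @measurable_to_bool _ m _ ?_
      have e : τ ⁻¹' ((fun b : ℕ → Bool => b n) ⁻¹' {true}) = F n :=
        Set.ext fun x => decide_eq_true_iff
      change MapsInd V {x | φ x n = true} (τ ⁻¹' ((fun b : ℕ → Bool => b n) ⁻¹' {true}))
      rw [e]
      exact hF n
    exact hle
  have hall : ∀ E, ∀ hE : MeasurableSet E,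
      V (ind μ hE) =ᵐ[μ] (τ ⁻¹' (φ '' E)).indicator fun _ => (1 : ℂ) := by
    intro E hE
    have hB : MapsInd V (φ ⁻¹' (φ '' E)) (τ ⁻¹' (φ '' E)) :=
      hpre _ (hφ.measurableSet_image.2 hE)
    obtain ⟨h1, h2⟩ := hB
    have e : ind μ h1 = ind μ hE := by
      congr 1
      exact Set.preimage_image_eq E hφi
    rwa [e] at h2
  -- Since `V 𝟙 = 𝟙`, the preimage of the range of `φ` has full measure.
  have hrange : ∀ᵐ x ∂μ, τ x ∈ Set.range φ := by
    have h := hall _ MeasurableSet.univ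
    have e : ind μ (MeasurableSet.univ : MeasurableSet (Set.univ : Set X)) = one μ :=
      indicatorConstLp_univ 2 μ (1 : ℂ)
    rw [e, hone, Set.image_univ] at h
    filter_upwards [h, coeFn_one (μ := μ)] with x h1 h2
    rw [h2] at h1
    by_contra hx
    rw [Set.indicator_of_notMem (by exact hx)] at h1
    exact one_ne_zero h1
  have hne : Nonempty X := nonempty_of_isProbabilityMeasure μ
  -- Off the range of `φ` the value of `invFun` is arbitrary, which matters only on a null set.
  refine ⟨fun x => Function.invFun φ (τ x), fun E hE => (hall E hE).trans ?_⟩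
  filter_upwards [hrange] with x hx
  have hinvx : φ (Function.invFun φ (τ x)) = τ x := Function.invFun_eq hx
  have hiff : x ∈ τ ⁻¹' (φ '' E) ↔ x ∈ (fun x => Function.invFun φ (τ x)) ⁻¹' E := by
    rw [Set.mem_preimage, Set.mem_preimage, ← hinvx, hφi.mem_set_image, hinvx]
  by_cases h : x ∈ τ ⁻¹' (φ '' E)
  · rw [Set.indicator_of_mem h, Set.indicator_of_mem (hiff.1 h)]
  · rw [Set.indicator_of_notMem h, Set.indicator_of_notMem (mt hiff.2 h)]

theorem exists_comp_eq [StandardBorelSpace X] (hone : V (one μ) = one μ)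
    (hinv : ∀ f ∈ linf μ, V f ∈ linf μ)
    (hmul : ∀ f ∈ linf μ, ∀ g ∈ linf μ, V (pmul f g) = pmul (V f) (V g)) :
    ∃ T : X → X, ∀ (f : X → ℂ) (hf : MemLp f 2 μ), V hf.toLp =ᵐ[μ] fun x => f (T x) := by
  obtain ⟨T, hT⟩ := exists_mapsInd_preimage hone hinv hmul
  -- `T` pulls null sets back to null sets because `V` sends the zero class to zero; this makes
  -- composition with `T` independent of representatives.
  have hnull : ∀ {p : X → Prop}, (∀ᵐ x ∂μ, p x) → ∀ᵐ x ∂μ, p (T x) := by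
    intro p hp
    obtain ⟨N, hN, hNm, hN0⟩ := exists_measurable_superset_of_null (ae_iff.1 hp)
    have h0 : ind μ hNm = 0 := by
      refine Lp.ext ((coeFn_ind hNm).trans ((?_ : _ =ᵐ[μ] _).trans (Lp.coeFn_zero ℂ 2 μ).symm))
      exact indicator_meas_zero hN0
    have h := hT N hNm
    rw [h0, map_zero] at h
    filter_upwards [h, Lp.coeFn_zero ℂ 2 μ] with x h1 h2
    by_contra hx
    rw [h2, Set.indicator_of_mem (show x ∈ T ⁻¹' N from hN hx)] at h1
    exact zero_ne_one h1
  refine ⟨T, fun f hf => ?_⟩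
  suffices H : ∀ hf : MemLp f 2 μ, V hf.toLp =ᵐ[μ] fun x => f (T x) from H hf
  refine MemLp.induction (p := 2) (by simp)
    (fun f => ∀ hf : MemLp f 2 μ, V hf.toLp =ᵐ[μ] fun x => f (T x)) ?_ ?_ ?_ ?_ hf
  · intro c s hs _ hf
    have e : hf.toLp = c • ind μ hs := by
      refine Lp.ext ?_
      filter_upwards [hf.coeFn_toLp, coeFn_ind (μ := μ) hs, Lp.coeFn_smul c (ind μ hs)]
        with x h1 h2 h3
      rw [h1, h3, Pi.smul_apply, h2]
      by_cases h : x ∈ s <;> simp [h]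
    rw [e, map_smul]
    filter_upwards [hT s hs, Lp.coeFn_smul c (V (ind μ hs))] with x h1 h2
    rw [h2, Pi.smul_apply, h1]
    by_cases h : T x ∈ s <;> simp [h]
  · intro f g _ hf hg h1 h2 hfg
    have e : hfg.toLp = hf.toLp + hg.toLp := MemLp.toLp_add hf hg
    rw [e, map_add]
    filter_upwards [h1 hf, h2 hg, Lp.coeFn_add (V hf.toLp) (V hg.toLp)] with x e1 e2 e3
    rw [e3, Pi.add_apply, e1, e2, Pi.add_apply]
  · refine isClosed_of_closure_subset fun f hf => ?_
    obtain ⟨u, hu, hlim⟩ := mem_closure_iff_seq_limit.1 hf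
    obtain ⟨ns, hns, hae⟩ := (tendstoInMeasure_of_tendsto_Lp hlim).exists_seq_tendsto_ae
    -- A second extraction along the first: `u n` must converge a.e. (then be composed with `T`) and
    -- `V (u n)` must converge a.e. along the same indices.
    obtain ⟨ks, hks, hae'⟩ := (tendstoInMeasure_of_tendsto_Lp
      (((V.continuous.tendsto f).comp hlim).comp hns.tendsto_atTop)).exists_seq_tendsto_ae
    intro hf'
    rw [Lp.toLp_coeFn]
    have hall : ∀ᵐ x ∂μ, ∀ n, V (u n) x = u n (T x) := by
      refine ae_all_iff.2 fun n => ?_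
      have := hu n (Lp.memLp _)
      rwa [Lp.toLp_coeFn] at this
    filter_upwards [hnull hae, hae', hall] with x h1 h2 h3
    refine tendsto_nhds_unique h2 ((h1.comp hks.tendsto_atTop).congr fun n => ?_)
    exact (h3 _).symm
  · intro f g hfg hf h hg
    have e : hg.toLp = hf.toLp := (MemLp.toLp_eq_toLp_iff hg hf).2 hfg.symm
    rw [e]
    filter_upwards [h hf, hnull hfg] with x h1 h2
    rw [h1, h2]

end PointRealization

/-! ### Weighted composition groups: product rule and weight -/

section WeightedComposition

variable {X : Type*} [MeasurableSpace X] {μ : Measure X}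

theorem coeFn_subMul {U : ℝ → Lp ℂ 2 μ →L[ℂ] Lp ℂ 2 μ} {a : Lp ℂ 2 μ} (ha : a ∈ linf μ)
    (f : (subMul (generator U) a ha).domain) {f' : Lp ℂ 2 μ} (hf : HasOrbitDeriv U f f') :
    subMul (generator U) a ha f =ᵐ[μ] fun x => f' x - a x * (f : Lp ℂ 2 μ) x := by
  have e : subMul (generator U) a ha f = f' - mulOp a ha f := by
    rw [← (generator_spec U (f : (generator U).domain)).unique hf]
    rfl
  rw [e]
  filter_upwards [Lp.coeFn_sub f' (mulOp a ha f), (memLp_mul ha (f : Lp ℂ 2 μ)).coeFn_toLp]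
    with x h1 h2
  rw [h1, Pi.sub_apply]
  exact congrArg _ h2

theorem coeFn_leibniz {a f g : Lp ℂ 2 μ} (ha : a ∈ linf μ) (hf : f ∈ linf μ) (hg : g ∈ linf μ)
    (f' g' : Lp ℂ 2 μ) : (pmul f g' + pmul f' g - pmul a (pmul f g) : Lp ℂ 2 μ) =ᵐ[μ]
      fun x => f x * g' x + f' x * g x - a x * (f x * g x) := by
  filter_upwards [coeFn_pmul hf g', coeFn_pmul' f' hg, coeFn_pmul ha (pmul f g), coeFn_pmul hf g,
    Lp.coeFn_sub (pmul f g' + pmul f' g) (pmul a (pmul f g)),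
    Lp.coeFn_add (pmul f g') (pmul f' g)] with x h1 h2 h3 h4 h5 h6
  rw [h5, Pi.sub_apply, h6, Pi.add_apply, h1, h2, h3, h4]

/-- Expanding the derivation rule for `A - a`, two terms `a f g` appear on the right and one on the
left, leaving the correction `- a f g`. The existence of the orbit derivative of `fg` is the algebra
property. -/
theorem isLeibniz_iff {U : ℝ → Lp ℂ 2 μ →L[ℂ] Lp ℂ 2 μ} {a : Lp ℂ 2 μ} (ha : a ∈ linf μ) :
    (IsAlgebra ((generator U).domain ⊓ linf μ) ∧
      IsDerivationOn (subMul (generator U) a ha) ((generator U).domain ⊓ linf μ)) ↔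
      IsLeibniz U a := by
  constructor
  · rintro ⟨halg, hder⟩ f hf g hg f' g' hff hgg
    obtain ⟨h, ⟨⟨h', hh⟩, -⟩, hfg⟩ := halg f ⟨⟨f', hff⟩, hf⟩ g ⟨⟨g', hgg⟩, hg⟩
    have e : h = pmul f g := Lp.ext (hfg.trans (coeFn_pmul hf g).symm)
    have hB := hder ⟨f, f', hff⟩ ⟨g, g', hgg⟩ ⟨h, h', hh⟩ ⟨⟨f', hff⟩, hf⟩ ⟨⟨g', hgg⟩, hg⟩ hfg
    have e' : h' = pmul f g' + pmul f' g - pmul a (pmul f g) := by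
      refine Lp.ext ?_
      filter_upwards [hB, hfg, coeFn_subMul ha ⟨f, f', hff⟩ hff, coeFn_subMul ha ⟨g, g', hgg⟩ hgg,
        coeFn_subMul ha ⟨h, h', hh⟩ hh, coeFn_leibniz ha hf hg f' g'] with x h1 h2 h3 h4 h5 h6
      rw [h6]
      rw [h3, h4, h5] at h1
      rw [h2] at h1
      linear_combination h1
    rw [← e', ← e]
    exact hh
  · intro hL
    constructor
    · rintro f ⟨⟨f', hff⟩, hf⟩ g ⟨⟨g', hgg⟩, hg⟩
      exact ⟨pmul f g, ⟨⟨_, hL f hf g hg f' g' hff hgg⟩, pmul_mem_linf hf hg⟩, coeFn_pmul hf g⟩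
    · rintro ⟨f, f', hff⟩ ⟨g, g', hgg⟩ ⟨h, hh⟩ ⟨-, hf⟩ ⟨-, hg⟩ hfg
      have e : h = pmul f g := Lp.ext (hfg.trans (coeFn_pmul hf g).symm)
      have hd : HasOrbitDeriv U h (pmul f g' + pmul f' g - pmul a (pmul f g)) := by
        rw [e]
        exact hL f hf g hg f' g' hff hgg
      filter_upwards [hfg, coeFn_subMul ha ⟨f, f', hff⟩ hff, coeFn_subMul ha ⟨g, g', hgg⟩ hgg,
        coeFn_subMul ha ⟨h, hh⟩ hd, coeFn_leibniz ha hf hg f' g'] with x h2 h3 h4 h5 h6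
      rw [h3, h4, h5, h6]
      change h x = f x * g x at h2
      change _ = (f' x - a x * f x) * g x + f x * (g' x - a x * g x)
      rw [h2]
      ring

/-- Multiplication by a bounded function, as a bounded operator. -/
def mulCLM (m : Lp ℂ 2 μ) (hm : m ∈ linf μ) : Lp ℂ 2 μ →L[ℂ] Lp ℂ 2 μ :=
  LinearMap.mkContinuousOfExistsBound (mulOp m hm) (by
    obtain ⟨C, -, hC⟩ := exists_mem_supBall_of_linf hm
    refine ⟨C, fun f => Lp.norm_le_mul_norm_of_ae_le_mul ?_⟩
    filter_upwards [(memLp_mul hm f).coeFn_toLp, hC] with x h1 h2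
    refine (congrArg norm h1).trans_le ?_
    rw [norm_mul]
    gcongr)

theorem mulCLM_apply {m : Lp ℂ 2 μ} (hm : m ∈ linf μ) (f : Lp ℂ 2 μ) :
    mulCLM m hm f = pmul m f :=
  Lp.ext ((memLp_mul hm f).coeFn_toLp.trans (coeFn_pmul hm f).symm)

variable {U : ℝ → Lp ℂ 2 μ →L[ℂ] Lp ℂ 2 μ} {T : ℝ → X → X} {ψ : ℝ → X → ℂ}

theorem IsWeightedComposition.coeFn_apply (hc : IsWeightedComposition U T ψ) (t : ℝ)
    (f : Lp ℂ 2 μ) : U t f =ᵐ[μ] fun x => ψ t x * f (T t x) := by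
  have := hc t f (Lp.memLp f)
  rwa [Lp.toLp_coeFn] at this

theorem IsWeightedComposition.coeFn_apply_pmul (hc : IsWeightedComposition U T ψ) (t : ℝ)
    {f : Lp ℂ 2 μ} (hf : f ∈ linf μ) (g : Lp ℂ 2 μ) :
    U t (pmul f g) =ᵐ[μ] fun x => ψ t x * (f (T t x) * g (T t x)) := by
  have h := hc t _ (memLp_mul hf g)
  have e : (memLp_mul hf g).toLp = pmul f g :=
    Lp.ext ((memLp_mul hf g).coeFn_toLp.trans (coeFn_pmul hf g).symm)
  rwa [e] at h

variable [IsProbabilityMeasure μ]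

/-- For `f = U_{-t} 𝟙`, multiplicativity reads `U_t(f²) · U_t 𝟙 = (U_t f)² = 𝟙`, so `U_t(f²)` is a
bounded inverse. -/
theorem IsWeightedMul.exists_inverse (hM : IsWeightedMul U) (hU : IsC0Group U)
    (hinv : ∀ t : ℝ, ∀ f ∈ linf μ, U t f ∈ linf μ) (t : ℝ) :
    ∃ k ∈ linf μ, pmul k (U t (one μ)) = one μ := by
  have hf := hinv (-t) _ one_mem_linf
  refine ⟨_, hinv t _ (pmul_mem_linf hf hf), ?_⟩
  rw [hM t _ hf _ hf, hU.apply_apply_neg, pmul_one]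

theorem IsWeightedMul.isWeightedNonsingular [StandardBorelSpace X] (hM : IsWeightedMul U)
    (hU : IsC0Group U) (hinv : ∀ t : ℝ, ∀ f ∈ linf μ, U t f ∈ linf μ) :
    IsWeightedNonsingular U := by
  have H : ∀ t, ∃ T : X → X, ∀ (f : X → ℂ) (hf : MemLp f 2 μ),
      U t hf.toLp =ᵐ[μ] fun x => U t (one μ) x * f (T x) := by
    intro t
    obtain ⟨k, hk, hk1⟩ := hM.exists_inverse hU hinv t
    have hψ := hinv t _ one_mem_linf
    have hψk : pmul (U t (one μ)) k = one μ := by rw [pmul_comm, hk1]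
    let V := (mulCLM k hk).comp (U t)
    have hV : ∀ f, V f = pmul k (U t f) := fun f => mulCLM_apply hk _
    have hUV : ∀ f, U t f = pmul (U t (one μ)) (V f) := fun f => by
      rw [hV, ← pmul_assoc hψ hk, hψk, one_pmul]
    obtain ⟨T, hT⟩ := exists_comp_eq (V := V) (by rw [hV, hk1])
      (fun f hf => by rw [hV]; exact pmul_mem_linf hk (hinv t f hf))
      (fun f hf g hg => by
        have hf' := hinv t f hf
        have hg' := hinv t g hg
        have hfg' := hinv t _ (pmul_mem_linf hf hg)
        -- `V f · V g = k² · U_t f · U_t g = k² · U_t(fg) · U_t 𝟙 = k · U_t(fg)`.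
        rw [hV, hV, hV, pmul_comm k (U t g), ← pmul_assoc (pmul_mem_linf hk hf') hg',
          pmul_assoc hk hf', ← hM t f hf g hg, pmul_assoc hk (pmul_mem_linf hfg' hψ),
          pmul_assoc hfg' hψ, hψk, pmul_one])
    refine ⟨T, fun f hf => ?_⟩
    rw [hUV]
    filter_upwards [coeFn_pmul hψ (V hf.toLp), hT f hf] with x h1 h2
    rw [h1, h2]
  choose T hT using H
  exact ⟨T, fun t => U t (one μ), hT⟩

theorem IsWeightedComposition.weight_eq (hc : IsWeightedComposition U T ψ) (t : ℝ) :
    U t (one μ) =ᵐ[μ] ψ t := by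
  have := hc t (fun _ => (1 : ℂ)) (memLp_const 1)
  rw [MemLp.toLp_const] at this
  simp only [mul_one] at this
  exact this

theorem IsWeightedComposition.isWeightedMul (hc : IsWeightedComposition U T ψ)
    (hinv : ∀ t : ℝ, ∀ f ∈ linf μ, U t f ∈ linf μ) : IsWeightedMul U := by
  intro t f hf g hg
  refine Lp.ext ?_
  filter_upwards [hc.coeFn_apply_pmul t hf g, hc.coeFn_apply t f, hc.coeFn_apply t g,
    hc.weight_eq t, coeFn_pmul (hinv t f hf) (U t g),
    coeFn_pmul (hinv t _ (pmul_mem_linf hf hg)) (U t (one μ))] with x h1 h2 h3 h4 h5 h6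
  rw [h6, h5, h1, h2, h3, h4]
  ring

/-- `𝟙 = U_t(U_{-t} 𝟙)` is a multiple of `ψ_t`. -/
theorem IsWeightedComposition.weight_ne_zero (hc : IsWeightedComposition U T ψ)
    (hU : IsC0Group U) (t : ℝ) : ∀ᵐ x ∂μ, ψ t x ≠ 0 := by
  have h := hc.coeFn_apply t (U (-t) (one μ))
  rw [hU.apply_apply_neg] at h
  filter_upwards [h, coeFn_one (μ := μ)] with x h1 h2 h0
  rw [h2, h0, zero_mul] at h1
  exact one_ne_zero h1

/-- The formula for `U_t` holds for every representative, in particular for the indicator of the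
exceptional set, which represents `0`; as `ψ_t ≠ 0` a.e., its composition with `T t` vanishes a.e.
-/
theorem IsWeightedComposition.ae_comp (hc : IsWeightedComposition U T ψ)
    (hU : IsC0Group U) (t : ℝ) {p : X → Prop} (hp : ∀ᵐ x ∂μ, p x) : ∀ᵐ x ∂μ, p (T t x) := by
  classical
  have h0 : (fun x => if p x then (0 : ℂ) else 1) =ᵐ[μ] fun _ => 0 := by
    filter_upwards [hp] with x hx
    rw [if_pos hx]
  have hm : MemLp (fun x => if p x then (0 : ℂ) else 1) 2 μ := (memLp_const 0).ae_eq h0.symm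
  have e : hm.toLp = 0 := Lp.ext (hm.coeFn_toLp.trans (h0.trans (Lp.coeFn_zero ℂ 2 μ).symm))
  have h := hc t _ hm
  rw [e, map_zero] at h
  filter_upwards [h, hc.weight_ne_zero hU t, Lp.coeFn_zero ℂ 2 μ] with x h1 h2 h3
  by_contra hx
  rw [h3, if_neg hx, mul_one] at h1
  exact h2 h1.symm

/-- Dividing `U_t f` by the boundedly invertible weight shows that `f ∘ T_t` represents an element
of `L₂`. -/
theorem IsWeightedComposition.exists_koopman (hc : IsWeightedComposition U T ψ)
    (hU : IsC0Group U) (hinv : ∀ t : ℝ, ∀ f ∈ linf μ, U t f ∈ linf μ) :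
    ∃ W : ℝ → Lp ℂ 2 μ → Lp ℂ 2 μ, ∀ t f, W t f =ᵐ[μ] fun x => f (T t x) := by
  choose k hk hk1 using (hc.isWeightedMul hinv).exists_inverse hU hinv
  refine ⟨fun t f => pmul (k t) (U t f), fun t f => ?_⟩
  have h := coeFn_pmul (hk t) (U t (one μ))
  rw [hk1] at h
  filter_upwards [h, coeFn_one (μ := μ), hc.weight_eq t, hc.coeFn_apply t f,
    coeFn_pmul (hk t) (U t f)] with x h1 h2 h3 h4 h5
  rw [h5, h4, ← h3, ← mul_assoc, ← h1, h2, one_mul]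

variable {W : ℝ → Lp ℂ 2 μ → Lp ℂ 2 μ}

theorem IsWeightedComposition.apply_eq_pmul (hc : IsWeightedComposition U T ψ)
    (hinv : ∀ t : ℝ, ∀ f ∈ linf μ, U t f ∈ linf μ)
    (hW : ∀ t f, W t f =ᵐ[μ] fun x => f (T t x)) (t : ℝ) (f : Lp ℂ 2 μ) :
    U t f = pmul (U t (one μ)) (W t f) := by
  refine Lp.ext ?_
  filter_upwards [hc.coeFn_apply t f, hW t f, hc.weight_eq t,
    coeFn_pmul (hinv t _ one_mem_linf) (W t f)] with x h1 h2 h3 h4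
  rw [h4, h1, h2, h3]

theorem IsWeightedComposition.koopman_mem_supBall (hc : IsWeightedComposition U T ψ)
    (hU : IsC0Group U) (hW : ∀ t f, W t f =ᵐ[μ] fun x => f (T t x)) (t : ℝ) {f : Lp ℂ 2 μ} {C : ℝ}
    (hf : f ∈ supBall μ C) : W t f ∈ supBall μ C := by
  filter_upwards [hW t f, hc.ae_comp hU t hf] with x h1 h2
  rw [h1]
  exact h2

/-- Since `U_{t₀} 𝟙 · W_t f = U_t f - (U_t 𝟙 - U_{t₀} 𝟙) · W_t f` and `W_t f` is uniformly bounded,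
the left side converges. Only the inverse of the weight at the fixed time `t₀` is then used, so no
uniform bound on inverses is needed. -/
theorem IsWeightedComposition.continuous_koopman (hc : IsWeightedComposition U T ψ)
    (hU : IsC0Group U) (hinv : ∀ t : ℝ, ∀ f ∈ linf μ, U t f ∈ linf μ)
    (hW : ∀ t f, W t f =ᵐ[μ] fun x => f (T t x)) {f : Lp ℂ 2 μ} (hf : f ∈ linf μ) :
    Continuous fun t => W t f := by
  refine continuous_iff_continuousAt.2 fun t₀ => ?_
  obtain ⟨C, -, hC⟩ := exists_mem_supBall_of_linf hf
  obtain ⟨k, hk, hk1⟩ := (hc.isWeightedMul hinv).exists_inverse hU hinv t₀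
  have hψ := fun t => hinv t _ (one_mem_linf (μ := μ))
  have hWk : ∀ t, pmul k (pmul (U t₀ (one μ)) (W t f)) = W t f := fun t => by
    rw [← pmul_assoc hk (hψ t₀), hk1, one_pmul]
  have hsmall : Tendsto (fun t => pmul (U t (one μ) - U t₀ (one μ)) (W t f)) (𝓝 t₀) (𝓝 0) := by
    have hlim : Tendsto (fun t => C * ‖U t (one μ) - U t₀ (one μ)‖) (𝓝 t₀) (𝓝 0) := by
      simpa using (tendsto_iff_norm_sub_tendsto_zero.1
        ((hU.continuous_orbit (one μ)).tendsto t₀)).const_mul C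
    refine squeeze_zero_norm (fun t => ?_) hlim
    rw [pmul_comm]
    exact norm_pmul_le (hc.koopman_mem_supBall hU hW t hC) _
  have hlim := ((hU.continuous_orbit f).tendsto t₀).sub hsmall
  have hmain : Tendsto (fun t => pmul (U t₀ (one μ)) (W t f)) (𝓝 t₀)
      (𝓝 (pmul (U t₀ (one μ)) (W t₀ f))) := by
    rw [sub_zero, hc.apply_eq_pmul hinv hW t₀ f] at hlim
    refine hlim.congr fun t => ?_
    rw [hc.apply_eq_pmul hinv hW t f, sub_pmul' (hψ t) (hψ t₀), sub_sub_cancel]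
  have := tendsto_const_pmul hk hmain
  simp only [hWk] at this
  exact this

/-- Divide `U_t(fg) - fg = W_t g · (U_t f - f · U_t 𝟙) + f · (U_t g - g)` by `t`; the factor `W_t g`
is uniformly bounded and tends to `g`. -/
theorem IsWeightedComposition.isLeibniz (hc : IsWeightedComposition U T ψ)
    (hU : IsC0Group U) (hinv : ∀ t : ℝ, ∀ f ∈ linf μ, U t f ∈ linf μ) {a : Lp ℂ 2 μ}
    (h1 : HasOrbitDeriv U (one μ) a) : IsLeibniz U a := by
  obtain ⟨W, hW⟩ := hc.exists_koopman hU hinv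
  intro f hf g hg f' g' hff hgg
  have hψ := fun t => hinv t _ (one_mem_linf (μ := μ))
  have hW0 : W 0 g = g := by
    have := hc.apply_eq_pmul hinv hW 0 g
    rwa [hU.apply_zero, hU.apply_zero, one_pmul, eq_comm] at this
  obtain ⟨C, -, hC⟩ := exists_mem_supBall_of_linf hg
  have hWb := fun t => hc.koopman_mem_supBall hU hW t hC
  have hWl := fun t => linf_of_mem_supBall (hWb t)
  have hWlim : Tendsto (fun t => W t g) (𝓝[≠] 0) (𝓝 g) := by
    have := (hc.continuous_koopman hU hinv hW hg).tendsto 0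
    rw [hW0] at this
    exact this.mono_left nhdsWithin_le_nhds
  rw [hU.hasOrbitDeriv_iff, hasDerivAt_iff_tendsto_slope] at h1 hff hgg ⊢
  have e : pmul f g' + pmul f' g - pmul a (pmul f g)
      = pmul g (f' - pmul f a) + pmul f g' := by
    rw [pmul_sub hg, pmul_comm f' g, ← pmul_assoc hg hf, pmul_comm a, pmul_comm f g]
    abel
  rw [e]
  refine ((tendsto_pmul hWlim (hff.sub (tendsto_const_pmul hf h1))
    (Eventually.of_forall hWb)).add (tendsto_const_pmul hf hgg)).congr fun t => ?_
  have e1 : U t (pmul f g) = pmul (W t g) (U t f) := by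
    refine Lp.ext ?_
    filter_upwards [hc.coeFn_apply_pmul t hf g, hc.coeFn_apply t f, hW t g,
      coeFn_pmul (hWl t) (U t f)] with x h1 h2 h3 h4
    rw [h4, h1, h2, h3]
    ring
  have e2 : pmul (W t g) (pmul f (U t (one μ))) = pmul f (U t g) := by
    rw [hc.apply_eq_pmul hinv hW t g, ← pmul_assoc (hWl t) hf, pmul_comm (W t g) f,
      pmul_assoc hf (hWl t), pmul_comm (W t g)]
  simp only [slope_def_module, hU.apply_zero]
  rw [pmul_smul hf, pmul_smul hf, ← smul_sub, pmul_smul (hWl t), ← smul_add, e1,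
    pmul_sub (hWl t), pmul_sub (hWl t), pmul_sub hf, pmul_sub (hWl t), e2, pmul_one, pmul_sub hf,
    pmul_comm (W t g) f]
  congr 1
  abel

/-- The weight solves the linear equation `(U_t 𝟙)' = U_t 𝟙 · W_t a`. Multiplying by the integrating
factor `exp(F t)`, `F t = -∫_0^t W_r a dr`, gives zero derivative and value `𝟙` at `0`; no cocycle
identity for `T` is needed. Boundedness of `a` makes `F` Lipschitz in sup norm, as `hasDerivAt_pexp`
requires. -/
theorem IsWeightedComposition.weight_eq_exp (hc : IsWeightedComposition U T ψ)
    (hU : IsC0Group U) (hinv : ∀ t : ℝ, ∀ f ∈ linf μ, U t f ∈ linf μ)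
    (hW : ∀ t f, W t f =ᵐ[μ] fun x => f (T t x)) {a : Lp ℂ 2 μ}
    (ha : a ∈ linf μ) (h1 : HasOrbitDeriv U (one μ) a) (t : ℝ) :
    ψ t =ᵐ[μ] fun x => Complex.exp ((∫ r in (0 : ℝ)..t, W r a : Lp ℂ 2 μ) x) := by
  obtain ⟨C, hC0, hC⟩ := exists_mem_supBall_of_linf ha
  have hWc := hc.continuous_koopman hU hinv hW ha
  have hWb := fun t => hc.koopman_mem_supBall hU hW t hC
  have hWi := fun s t => hWc.intervalIntegrable (μ := volume) s t
  have hψ := fun t => hinv t _ (one_mem_linf (μ := μ))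
  let F : ℝ → Lp ℂ 2 μ := fun t => -∫ r in (0 : ℝ)..t, W r a
  have hFsub : ∀ s t, F s - F t ∈ supBall μ (C * |s - t|) := by
    intro s t
    have e : F s - F t = ∫ r in s..t, W r a := by
      rw [← intervalIntegral.integral_interval_sub_left (hWi 0 t) (hWi 0 s)]
      simp only [F]
      abel
    rw [e, abs_sub_comm]
    exact integral_mem_supBall hWc fun r _ => hWb r
  have hF0 : F 0 = 0 := by simp [F]
  have hFb : ∀ s, F s ∈ supBall μ (C * |s|) := fun s => by
    simpa [hF0] using hFsub s 0
  have hFl := fun s => linf_of_mem_supBall (hFb s)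
  have hFd : ∀ s, HasDerivAt F (-W s a) s := fun s =>
    (hWc.integral_hasStrictDerivAt 0 s).hasDerivAt.neg
  have hEd : ∀ s, HasDerivAt (fun s => pmul (pexp (F s)) (U s (one μ))) 0 s := by
    intro s
    have hbd : ∀ᶠ r in 𝓝 s, pexp (F r) ∈ supBall μ (Real.exp (C * (|s| + 1))) := by
      filter_upwards [continuous_abs.continuousAt.eventually_lt_const (lt_add_one |s|)] with r hr
      refine pexp_mem_supBall (supBall_mono ?_ (hFb r))
      gcongr
    refine (hasDerivAt_pmul (hasDerivAt_pexp (hFd s) (fun r => hFsub r s) hFl)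
      (hU.hasDerivAt h1 s) hbd (hψ s)).congr_deriv ?_
    have hE := linf_of_mem_supBall (pexp_mem_supBall (hFb s))
    rw [hc.apply_eq_pmul hinv hW s a]
    refine Lp.ext ?_
    filter_upwards [Lp.coeFn_zero ℂ 2 μ, Lp.coeFn_neg (W s a),
      Lp.coeFn_add (pmul (pexp (F s)) (pmul (U s (one μ)) (W s a)))
        (pmul (pmul (pexp (F s)) (-W s a)) (U s (one μ))),
      coeFn_pmul hE (pmul (U s (one μ)) (W s a)), coeFn_pmul (hψ s) (W s a),
      coeFn_pmul' (pmul (pexp (F s)) (-W s a)) (hψ s), coeFn_pmul hE (-W s a)]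
      with x e1 e2 e3 e4 e5 e6 e7
    rw [e3, Pi.add_apply, e4, e5, e6, e7, e2, e1, Pi.neg_apply, Pi.zero_apply]
    ring
  have hconst : pmul (pexp (F t)) (U t (one μ)) = one μ := by
    have h := is_const_of_deriv_eq_zero (𝕜 := ℝ) (fun s => (hEd s).differentiableAt)
      (fun s => (hEd s).deriv) t 0
    rw [h, hF0, hU.apply_zero, pmul_one]
    have h0 : (0 : Lp ℂ 2 μ) ∈ linf μ := zero_mem _
    refine Lp.ext ?_
    filter_upwards [coeFn_pexp h0, coeFn_one (μ := μ), Lp.coeFn_zero ℂ 2 μ] with x e1 e2 e3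
    rw [e1, e2, e3, Pi.zero_apply, Complex.exp_zero]
  have hE := coeFn_pmul (linf_of_mem_supBall (pexp_mem_supBall (hFb t))) (U t (one μ))
  rw [hconst] at hE
  filter_upwards [hE, coeFn_one (μ := μ), coeFn_pexp (hFl t), hc.weight_eq t,
    Lp.coeFn_neg (∫ r in (0 : ℝ)..t, W r a)] with x e1 e2 e3 e4 e5
  rw [e2, e3, e4, e5, Pi.neg_apply, Complex.exp_neg] at e1
  field_simp [Complex.exp_ne_zero] at e1
  exact e1.symm

end WeightedComposition

end WeightedKoopman

end

theorem theorem3p10 {X : Type*} [MeasurableSpace X] [StandardBorelSpace X]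
    (μ : Measure X) [IsProbabilityMeasure μ]
    (U : ℝ → Lp ℂ 2 μ →L[ℂ] Lp ℂ 2 μ) (hU : WeightedKoopman.IsC0Group U)
    (hinv : ∀ t : ℝ, ∀ f ∈ WeightedKoopman.linf μ, U t f ∈ WeightedKoopman.linf μ)
    (h1 : WeightedKoopman.one μ ∈ (WeightedKoopman.generator U).domain)
    (hA1 : WeightedKoopman.generator U ⟨WeightedKoopman.one μ, h1⟩ ∈ WeightedKoopman.linf μ) :
    (WeightedKoopman.IsWeightedNonsingular U ↔
      WeightedKoopman.IsAlgebra
          ((WeightedKoopman.generator U).domain ⊓ WeightedKoopman.linf μ) ∧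
        WeightedKoopman.IsDerivationOn
          (WeightedKoopman.subMul (WeightedKoopman.generator U)
            (WeightedKoopman.generator U ⟨WeightedKoopman.one μ, h1⟩) hA1)
          ((WeightedKoopman.generator U).domain ⊓ WeightedKoopman.linf μ)) ∧
    ∀ (T : ℝ → X → X) (ψ : ℝ → X → ℂ), WeightedKoopman.IsWeightedComposition U T ψ →
      ∃ g : ℝ → Lp ℂ 2 μ, Continuous g ∧
        (∀ r : ℝ, g r =ᵐ[μ]
          fun x => WeightedKoopman.generator U ⟨WeightedKoopman.one μ, h1⟩ (T r x)) ∧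
        ∀ t : ℝ, MemLp (ψ t) ∞ μ ∧
          ψ t =ᵐ[μ] fun x => Complex.exp ((∫ r in (0 : ℝ)..t, g r : Lp ℂ 2 μ) x) := by

  have h1' := WeightedKoopman.generator_spec U ⟨WeightedKoopman.one μ, h1⟩
  refine ⟨?_, fun T ψ hc => ?_⟩
  · rw [WeightedKoopman.isLeibniz_iff hA1]
    constructor
    · rintro ⟨T, ψ, hc⟩
      exact hc.isLeibniz hU hinv h1'
    · intro hL
      exact (hU.isWeightedMul_of_isLeibniz hinv hA1 h1' hL).isWeightedNonsingular hU hinv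
  · obtain ⟨W, hW⟩ := hc.exists_koopman hU hinv
    refine ⟨fun r => W r _, hc.continuous_koopman hU hinv hW hA1, fun r => hW r _, fun t => ⟨?_, ?_⟩⟩
    · exact (WeightedKoopman.mem_linf.1 (hinv t _ WeightedKoopman.one_mem_linf)).ae_eq
        (hc.weight_eq t)
    · exact hc.weight_eq_exp hU hinv hW hA1 h1' t
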